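/- Let $d\ge 1$ be an integer, $p\ge d+2$ real, $\beta:=p-d-1$, $\tau_1>0$, and let $K_\tau:\mathbb R^d\to\mathbb R$, $0<\tau<\tau_1$, be measurable kernels such that (i) there is $C_0>0$, independent of $\tau$, with $\frac1{C_0}(|\zeta|+\tau^{1/\beta})^{-p}\le K_\tau(\zeta)\le C_0(|\zeta|+\tau^{1/\beta})^{-p}$ for all $\zeta$; (ii) for every $\zeta\ne0$, $K_\tau(\zeta)$ increases as $\tau\downarrow0$ to $K_0(\zeta)$, where either $K_0(\zeta)=|\zeta|_1^{-p}$ for all $\zeta\neq 0$, or $K_0(\zeta)=|\zeta|^{-p}$ for all $\zeta\neq 0$; (iii) $K_\tau$ is invariant under permutations of the coordinates; (iv) $\widehat K_\tau(z):=\int_{\mathbb R^{d-1}}K_\tau(z,z')\,dz'$ is, as a function of $|z|$, the Laplace transform of a nonnegative function: $\widehat K_\tau(z)=\int_0^\infty f_\tau(\alpha)e^{-\alpha|z|}\,d\alpha$ for $z\ne0$, with $f_\tau\ge0$ measurable. For $0\le\tau<\tau_1$, $L>0$ and an $L$-periodic set $E\subset\mathbb R$ of locally finite perimeter let $$\mathcal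 F^1_{\tau,L}(E)=\frac1L\Big(-\mathrm{Per}(E,[0,L))+\int_{\mathbb R}\widehat K_\tau(z)\Big[\mathrm{Per}(E,[0,L))|z|-\int_0^L|\chi_E(x)-\chi_E(x+z)|\,dx\Big]dz\Big),$$ where $\mathrm{Per}(E,[0,L))$ is the number of points of the reduced boundary of $E$ in $[0,L)$. For $h>0$ let $E_h=\bigcup_{k\in\mathbb Z}[2kh,(2k+1)h]$; a set is called periodic stripes of period $h$ if, up to a Lebesgue null set, it is a translate of $E_h$. Then there are $C>0$ and $\hat\tau>0$ (depending only on $d$, $p$ and the family of kernels) such that for every $0\le\tau<\hat\tau$ there is $h^*_\tau>0$ whose stripes have the optimal energy density among all periodic sets of all periods, that is $$\mathcal F^1_{\tau,2h^*_\tau}(E_{h^*_\tau})\le\mathcal F^1_{\tau,L}(E)\quad\text{for all }L>0\text{ and all }L\text{-periodic }E\subset\mathbb R\text{ of locally finite perimeter},$$ and such that for every $L>0$ the functional $\mathcal F^1_{\tau,L}$ has a minimizer among the $L$-periodic sets of locally finite perimeter, and every minimizer is periodic stripes of some period $h_\tau>0$ with $$|h_\tau-h^*_\tau|\le\frac CL,$$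 except that, when $L\le C$, a minimizer may also be trivial, i.e. equal to $\emptyset$ or $\mathbb R$ up to a null set. -/

import Mathlib

open MeasureTheory Filter Topology

namespace StripeModel

noncomputable section

/-- The pair `(μ, ν)` is the Jordan decomposition of the distributional derivative of the
characteristic function of `E ⊆ ℝ`: `Dχ_E = μ - ν` is a locally finite signed measure, and
its total variation is `|Dχ_E| = μ + ν`. -/
structure IsJordanDeriv (E : Set ℝ) (μ ν : Measure ℝ) : Prop where
  locallyFinite_pos : IsLocallyFiniteMeasure μ
  locallyFinite_neg : IsLocallyFiniteMeasure ν
  mutuallySingular : μ ⟂ₘ ν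
  integral_deriv : ∀ φ : ℝ → ℝ, ContDiff ℝ (⊤ : ℕ∞) φ → HasCompactSupport φ →
    ∫ x in E, deriv φ x = -(∫ x, φ x ∂μ - ∫ x, φ x ∂ν)

/-- A (Lebesgue measurable) set of locally finite perimeter in `ℝ`: the distributional
derivative of its characteristic function is a locally finite (signed) measure. -/
def LocallyFinitePerimeter (E : Set ℝ) : Prop :=
  NullMeasurableSet E ∧ ∃ μ ν : Measure ℝ, IsJordanDeriv E μ ν

/-- The reduced boundary of `E`: the points `x` of the support of `|Dχ_E|` at which
`- lim_{r ↓ 0} Dχ_E(B(x,r)) / |Dχ_E|(B(x,r))` exists and has modulus one. -/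
def reducedBoundary (E : Set ℝ) : Set ℝ :=
  {x | ∃ μ ν : Measure ℝ, IsJordanDeriv E μ ν ∧
    (∀ r : ℝ, 0 < r → 0 < (μ + ν) (Metric.ball x r)) ∧
    ∃ n : ℝ, |n| = 1 ∧
      Tendsto (fun r : ℝ => -((μ.real (Metric.ball x r) - ν.real (Metric.ball x r)) /
        (μ + ν).real (Metric.ball x r))) (𝓝[>] 0) (𝓝 n)}

/-- The perimeter of `E` in `[0,L)`: the number of points of the reduced boundary there. -/
def perimeter (E : Set ℝ) (L : ℝ) : ℝ :=
  ((reducedBoundary E ∩ Set.Ico 0 L).ncard : ℝ)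

/-- The characteristic function. -/
def chi (E : Set ℝ) : ℝ → ℝ := E.indicator (fun _ => 1)

/-- The admissible sets: `L`-periodic sets of locally finite perimeter. -/
def PeriodicFinitePerimeter (L : ℝ) (E : Set ℝ) : Prop :=
  LocallyFinitePerimeter E ∧ ∀ x : ℝ, x + L ∈ E ↔ x ∈ E

/-- The exponent `β = p - d - 1`. -/
def betaExp (d : ℕ) (p : ℝ) : ℝ := p - d - 1

/-- The kernel integrated over the last `d - 1 = m` variables:
`K̂(z) = ∫_{ℝ^{d-1}} K(z, z') dz'`. -/
def marginal {m : ℕ} (K : EuclideanSpace ℝ (Fin (m + 1)) → ℝ) (z : ℝ) : ℝ :=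
  ∫ z' : Fin m → ℝ, K (WithLp.toLp 2 (Matrix.vecCons z z'))

/-- The standing assumptions on a family of kernels `K τ` on `ℝ^d`, `d = m + 1`. The kernels
are given for `0 < τ < τ₁`; `K 0` denotes their limit as `τ ↓ 0`. -/
structure IsKernelFamily (m : ℕ) (p τ₁ : ℝ)
    (K : ℝ → EuclideanSpace ℝ (Fin (m + 1)) → ℝ) : Prop where
  measurable : ∀ τ : ℝ, 0 < τ → τ < τ₁ → Measurable (K τ)
  bound : ∃ C : ℝ, 0 < C ∧ ∀ τ : ℝ, 0 < τ → τ < τ₁ →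
    ∀ ζ : EuclideanSpace ℝ (Fin (m + 1)),
      1 / C * (1 / (‖ζ‖ + τ ^ (1 / betaExp (m + 1) p)) ^ p) ≤ K τ ζ ∧
      K τ ζ ≤ C * (1 / (‖ζ‖ + τ ^ (1 / betaExp (m + 1) p)) ^ p)
  monotone : ∀ ζ : EuclideanSpace ℝ (Fin (m + 1)), ζ ≠ 0 →
    ∀ τ τ' : ℝ, 0 < τ → τ ≤ τ' → τ' < τ₁ → K τ' ζ ≤ K τ ζ
  tendsto : ∀ ζ : EuclideanSpace ℝ (Fin (m + 1)), ζ ≠ 0 →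
    Tendsto (fun τ => K τ ζ) (𝓝[>] 0) (𝓝 (K 0 ζ))
  limit : (∀ ζ : EuclideanSpace ℝ (Fin (m + 1)), ζ ≠ 0 → K 0 ζ = 1 / (∑ i, |ζ i|) ^ p) ∨
    (∀ ζ : EuclideanSpace ℝ (Fin (m + 1)), ζ ≠ 0 → K 0 ζ = 1 / ‖ζ‖ ^ p)
  symmetric : ∀ τ : ℝ, 0 < τ → τ < τ₁ → ∀ σ : Equiv.Perm (Fin (m + 1)),
    ∀ ζ : EuclideanSpace ℝ (Fin (m + 1)), K τ (WithLp.toLp 2 (fun i => ζ (σ i))) = K τ ζ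
  /-- `z ↦ K̂_τ(z) = ∫ K τ (z, z') dz'` is, as a function of `|z|`, the Laplace transform of a
  nonnegative function `f` on `(0, ∞)`. -/
  laplace : ∀ τ : ℝ, 0 < τ → τ < τ₁ → ∃ f : ℝ → ℝ, Measurable f ∧ (∀ α, 0 ≤ f α) ∧
    ∀ z : ℝ, z ≠ 0 →
      IntegrableOn (fun α => f α * Real.exp (-α * |z|)) (Set.Ioi 0) ∧
      marginal (K τ) z = ∫ α in Set.Ioi (0 : ℝ), f α * Real.exp (-α * |z|)

/-- The one-dimensional functional of an `L`-periodic set `E` for the kernel `k` on `ℝ`. -/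
def energy (k : ℝ → ℝ) (L : ℝ) (E : Set ℝ) : ℝ :=
  1 / L * (-perimeter E L +
    ∫ z : ℝ, k z * (perimeter E L * |z| - ∫ x in (0 : ℝ)..L, |chi E x - chi E (x + z)|))

/-- `E` minimizes the functional among `L`-periodic sets of locally finite perimeter. -/
def IsMinimizer (k : ℝ → ℝ) (L : ℝ) (E : Set ℝ) : Prop :=
  PeriodicFinitePerimeter L E ∧
    ∀ E' : Set ℝ, PeriodicFinitePerimeter L E' → energy k L E ≤ energy k L E'

/-- The set `E_h + ν = ⋃_{k ∈ ℤ} [2kh + ν, (2k+1)h + ν]`. -/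
def stripes (h ν : ℝ) : Set ℝ :=
  ⋃ k : ℤ, Set.Icc (2 * k * h + ν) ((2 * k + 1) * h + ν)

/-- `E` is, up to a Lebesgue null set, a union of periodic stripes of width and distance `h`
(this `h` is what is called the period of the stripes). -/
def IsPeriodicStripes (h : ℝ) (E : Set ℝ) : Prop :=
  0 < h ∧ ∃ ν : ℝ, E =ᵐ[volume] stripes h ν

/-- `h` is an optimal period: the energy density of `E_h` is the least one among all periodic
sets of locally finite perimeter, of all periods `L > 0`. -/
def IsOptimalPeriod (k : ℝ → ℝ) (h : ℝ) : Prop :=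
  0 < h ∧ ∀ L : ℝ, 0 < L → ∀ E : Set ℝ, PeriodicFinitePerimeter L E →
    energy k (2 * h) (stripes h 0) ≤ energy k L E

end

end StripeModel

/-!
For a fixed kernel `k`, the argument compares an arbitrary periodic set with equally spaced stripes
in two steps: a lower bound of the energy by a sum over the gaps between consecutive boundary
points, each gap contributing as if it belonged to stripes of its own width, and Jensen's inequality
for that sum.

*Lower bound.* By the assumption `laplace` the kernel is a superposition of the exponentials `exp (-α|z|)`, so it is
enough to treat one of them. Let `x₀ < ⋯ < x_N = x₀ + L` be the boundary points in one period, put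
`q_i = exp (-α (x_{i+1} - x_i))` and
`U_i = 1 - α ∫₀^∞ exp (-α w) |χ(x_i) - χ(x_i + w)| dw`. As `χ` jumps at each boundary point,
`U_i + q_i U_{i+1} = 1`, and the term `∫₀^∞ exp (-α z) ∫₀^L |χ(x) - χ(x + z)| dx dz`, which lowers
the energy, is `α⁻² ∑ (1 - q_i) U_{i+1}`. Summing the
recursion and its square over a period gives `∑ (1 - q_i) U_{i+1} = ∑ (1 - q_i²) U_{i+1}²`, so that
completing a square bounds this sum by `∑ (1 - q_i) / (1 + q_i)` (`cyclic_sum_le`), which is its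
value when all the gaps are equal (`cyclic_sum_eq`). After integration in `α`, with
`P(h) = ∫ f(α) · 4 / (α² (1 + exp (α h))) dα` (`stripePotential`), the energy satisfies
`L · energy ≥ ∑ (P(x_{i+1} - x_i) - 1)`, with equality for stripes
(`IsJumpProfile.sum_stripePotential_le`, `energy_stripes`).

*Minimization.* The function `φ = P - 1` is strictly convex and decreasing. By Jensen, among the
sets with `N` boundary points per period exactly the stripes of width `L / N` are optimal
(`mul_le_sum_of_convex`, `eq_of_sum_le_of_convex`). Stripes of width `h` have energy density
`φ(h) / h`, which is positive for small `h` (this is where `τ` has to be small), negative for large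
`h`, and lies strictly below the larger of its end values on any interval
(`div_lt_max_of_convex`). Hence an optimal width exists, it is bounded uniformly in `τ`, and for a
minimizer on the grid `{L / (2n)}` the reciprocals of the two widths differ by at most `2 / L`
(`abs_sub_le_of_grid_min`). The trivial sets have energy zero, so they can be minimizers only
if `L` is too small for stripes of negative energy.

*Structure of sets.* A set of locally finite perimeter agrees almost everywhere with a
right-continuous step function, whose jumps are the points of the reduced boundary whatever Jordan
decomposition is chosen (`IsJordanDeriv.exists_isStepVersion`, `reducedBoundary_eq`).

*Kernels.* The limit kernel is homogeneous, so its marginal is `c |z| ^ (-(p - m))`, itself a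
Laplace transform; it dominates all the other marginals, and these converge to it as `τ ↓ 0`, which
yields the two bounds on `φ` uniformly in `τ`.
-/

namespace StripeModel

noncomputable section

/-! ### The cyclic recursion and the mismatch of one exponential -/

theorem sum_range_succ_of_cyclic {N : ℕ} {U : ℕ → ℝ} (hU : U N = U 0) :
    ∑ i ∈ Finset.range N, U (i + 1) = ∑ i ∈ Finset.range N, U i := by
  have h := Finset.sum_range_sub U N
  rw [Finset.sum_sub_distrib] at h
  linarith

/-- The algebraic core of the lower bound. Summing the recursion and its square over the cycle
turns `∑ (1 - q i) U (i+1)` into `∑ (2 (1 - q i) U (i+1) - (1 - q i ^ 2) U (i+1) ^ 2)`, whose terms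
are at most `(1 - q i) / (1 + q i)`. -/
theorem cyclic_sum_le {N : ℕ} {q U : ℕ → ℝ} (hq0 : ∀ i < N, 0 ≤ q i) (hq1 : ∀ i < N, q i ≤ 1)
    (hU : U N = U 0) (hrec : ∀ i < N, U i = 1 - q i * U (i + 1)) :
    ∑ i ∈ Finset.range N, (1 - q i) * U (i + 1) ≤
      ∑ i ∈ Finset.range N, (1 - q i) / (1 + q i) := by
  have h1 : ∑ i ∈ Finset.range N, U (i + 1) = ∑ i ∈ Finset.range N, U i :=
    sum_range_succ_of_cyclic hU
  have h2 : ∑ i ∈ Finset.range N, U (i + 1) ^ 2 = ∑ i ∈ Finset.range N, U i ^ 2 :=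
    sum_range_succ_of_cyclic (U := fun i => U i ^ 2) (by simp [hU])
  have h3 : ∑ i ∈ Finset.range N, U i = ∑ i ∈ Finset.range N, (1 - q i * U (i + 1)) :=
    Finset.sum_congr rfl fun i hi => hrec i (Finset.mem_range.1 hi)
  have h4 : ∑ i ∈ Finset.range N, U i ^ 2 = ∑ i ∈ Finset.range N, (1 - q i * U (i + 1)) ^ 2 :=
    Finset.sum_congr rfl fun i hi => by rw [hrec i (Finset.mem_range.1 hi)]
  have h5 : ∑ i ∈ Finset.range N, (U (i + 1) - (1 - q i * U (i + 1))) = 0 := by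
    rw [Finset.sum_sub_distrib]; linarith
  have h6 : ∑ i ∈ Finset.range N, (U (i + 1) ^ 2 - (1 - q i * U (i + 1)) ^ 2) = 0 := by
    rw [Finset.sum_sub_distrib]; linarith
  have h7 : ∑ i ∈ Finset.range N, (1 - q i) * U (i + 1) =
      ∑ i ∈ Finset.range N, ((1 - q i) * U (i + 1) -
        (U (i + 1) ^ 2 - (1 - q i * U (i + 1)) ^ 2)
        + (U (i + 1) - (1 - q i * U (i + 1)))) := by
    rw [Finset.sum_add_distrib, h5, Finset.sum_sub_distrib, h6]; ring
  rw [h7]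
  refine Finset.sum_le_sum fun i hi => ?_
  have hi := Finset.mem_range.1 hi
  have a := hq0 i hi
  have b := hq1 i hi
  rw [le_div_iff₀ (by linarith)]
  nlinarith [mul_nonneg (sub_nonneg.2 b) (sq_nonneg ((1 + q i) * U (i + 1) - 1))]

/-- The case of equality of `cyclic_sum_le`: all the factors are equal. -/
theorem cyclic_sum_eq {N : ℕ} {r : ℝ} {U : ℕ → ℝ} (hr : 0 ≤ r)
    (hU : U N = U 0) (hrec : ∀ i < N, U i = 1 - r * U (i + 1)) :
    ∑ i ∈ Finset.range N, (1 - r) * U (i + 1) =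
      ∑ _i ∈ Finset.range N, (1 - r) / (1 + r) := by
  have h1 : ∑ i ∈ Finset.range N, U (i + 1) = ∑ i ∈ Finset.range N, U i :=
    sum_range_succ_of_cyclic hU
  have h3 : ∑ i ∈ Finset.range N, U i = ∑ i ∈ Finset.range N, (1 - r * U (i + 1)) :=
    Finset.sum_congr rfl fun i hi => hrec i (Finset.mem_range.1 hi)
  rw [Finset.sum_sub_distrib, ← Finset.mul_sum, ← h1] at h3
  simp only [Finset.sum_const, Finset.card_range, nsmul_eq_mul, mul_one] at h3 ⊢
  rw [← Finset.mul_sum]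
  have : (1 + r) ≠ 0 := by linarith
  field_simp
  linear_combination (1 - r) * h3

/-- `g` is an `L`-periodic, right-continuous function with values `0` and `1`, whose jumps in one
period are at the points `x 0 < x 1 < ⋯ < x N = x 0 + L`. The endpoint `x N` is included, so that the
gaps are `x (i + 1) - x i` for `i < N`; the values of `x` beyond `N` are irrelevant. -/
structure IsJumpProfile (g : ℝ → ℝ) (L : ℝ) (N : ℕ) (x : ℕ → ℝ) : Prop where
  measurable : Measurable g
  zero_or_one : ∀ y, g y = 0 ∨ g y = 1
  periodic : Function.Periodic g L
  lt : ∀ i < N, x i < x (i + 1)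
  const : ∀ i < N, ∀ y ∈ Set.Ico (x i) (x (i + 1)), g y = g (x i)
  flip : ∀ i < N, g (x (i + 1)) = 1 - g (x i)
  wrap : x N = x 0 + L

/-- The measure of the set of points `y` of one period at which `g y ≠ g (y + z)`, for a function
`g` with values `0` and `1`. -/
def mismatch (g : ℝ → ℝ) (L z : ℝ) : ℝ := ∫ y in (0 : ℝ)..L, |g y - g (y + z)|

/-- The mismatch between `g y` and the values of `g` to the right of `y`, with exponential weight. -/
def expMismatch (g : ℝ → ℝ) (α y : ℝ) : ℝ :=
  ∫ w in Set.Ioi (0 : ℝ), Real.exp (-α * w) * |g y - g (y + w)|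

section

variable {g : ℝ → ℝ} {L α : ℝ}

theorem abs_sub_le_one (h01 : ∀ y, g y = 0 ∨ g y = 1) (y z : ℝ) : |g y - g z| ≤ 1 := by
  rcases h01 y with h | h <;> rcases h01 z with h' | h' <;> simp [h, h']

theorem integrableOn_exp_neg (hα : 0 < α) :
    IntegrableOn (fun w => Real.exp (-α * w)) (Set.Ioi 0) :=
  integrableOn_exp_mul_Ioi (by linarith) 0

theorem integral_exp_neg (hα : 0 < α) : ∫ w in Set.Ioi (0 : ℝ), Real.exp (-α * w) = 1 / α := by
  rw [integral_exp_mul_Ioi (by linarith) 0]; simp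

theorem integrableOn_exp_mul_bdd (hα : 0 < α) {F : ℝ → ℝ} (hF : Measurable F)
    (hb : ∀ w, |F w| ≤ 1) :
    IntegrableOn (fun w => Real.exp (-α * w) * F w) (Set.Ioi 0) := by
  refine (integrableOn_exp_neg hα).mul_bdd (c := 1) hF.aestronglyMeasurable ?_
  exact Eventually.of_forall fun w => by simpa using hb w

/-- If `g` is constant on `[y, y + ℓ)` and jumps at `y + ℓ`, then matches and mismatches are
exchanged from there on. -/
theorem expMismatch_eq (hg : Measurable g) (h01 : ∀ y, g y = 0 ∨ g y = 1) (hα : 0 < α)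
    {y ℓ : ℝ} (hℓ : 0 ≤ ℓ) (hc : ∀ w ∈ Set.Ico y (y + ℓ), g w = g y)
    (hflip : g (y + ℓ) = 1 - g y) :
    expMismatch g α y = Real.exp (-α * ℓ) * (1 / α - expMismatch g α (y + ℓ)) := by
  have e1 : expMismatch g α y =
      ∫ w in Set.Ioi ℓ, Real.exp (-α * w) * |g y - g (y + w)| := by
    rw [expMismatch, ← integral_Ici_eq_integral_Ioi, ← integral_Ici_eq_integral_Ioi]
    refine setIntegral_eq_of_subset_of_forall_sdiff_eq_zero measurableSet_Ici
      (Set.Ici_subset_Ici.2 hℓ) ?_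
    rintro w ⟨hw0, hw⟩
    rw [hc (y + w) ⟨by simpa using hw0, by simpa using hw⟩]
    simp
  have e2 : ∫ w in Set.Ioi ℓ, Real.exp (-α * w) * |g y - g (y + w)| =
      ∫ w in Set.Ioi (0 : ℝ), Real.exp (-α * (w + ℓ)) * |g y - g (y + (w + ℓ))| := by
    have := (measurePreserving_add_right volume ℓ).setIntegral_preimage_emb
      (measurableEmbedding_addRight ℓ) (fun w => Real.exp (-α * w) * |g y - g (y + w)|)
      (Set.Ioi ℓ)
    rw [Set.preimage_add_const_Ioi, sub_self] at this
    exact this.symm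
  rw [e1, e2, expMismatch, ← integral_exp_neg hα, ← integral_sub (integrableOn_exp_neg hα),
    ← integral_const_mul]
  · refine setIntegral_congr_fun measurableSet_Ioi fun w _ => ?_
    have : |g y - g (y + (w + ℓ))| = 1 - |g (y + ℓ) - g (y + ℓ + w)| := by
      rw [hflip, show y + ℓ + w = y + (w + ℓ) by ring]
      rcases h01 y with h | h <;> rcases h01 (y + (w + ℓ)) with h' | h' <;> simp [h, h']
    simp only [this]
    rw [show -α * (w + ℓ) = -α * ℓ + -α * w by ring, Real.exp_add]
    ring
  · refine integrableOn_exp_mul_bdd hα (by fun_prop) fun w => ?_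
    rw [abs_abs]; exact abs_sub_le_one h01 _ _

theorem integrable_exp_mismatch_prod (hg : Measurable g) (h01 : ∀ y, g y = 0 ∨ g y = 1)
    (hα : 0 < α) (a b : ℝ) :
    Integrable (fun v : ℝ × ℝ => Real.exp (-α * v.2) * |g v.1 - g (v.1 + v.2)|)
      ((volume.restrict (Set.Ioc a b)).prod (volume.restrict (Set.Ioi 0))) := by
  have h1 : Integrable (fun v : ℝ × ℝ => (1 : ℝ) * Real.exp (-α * v.2))
      ((volume.restrict (Set.Ioc a b)).prod (volume.restrict (Set.Ioi 0))) :=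
    Integrable.mul_prod (f := fun _ => (1 : ℝ)) (integrable_const _) (integrableOn_exp_neg hα)
  refine h1.mono' (by fun_prop) (Eventually.of_forall fun v => ?_)
  rw [norm_mul, Real.norm_eq_abs, Real.norm_eq_abs, abs_abs, Real.abs_exp, one_mul]
  exact mul_le_of_le_one_right (Real.exp_pos _).le (abs_sub_le_one h01 _ _)

theorem intervalIntegrable_expMismatch (hg : Measurable g) (h01 : ∀ y, g y = 0 ∨ g y = 1)
    (hα : 0 < α) (a b : ℝ) : IntervalIntegrable (expMismatch g α) volume a b :=
  ⟨(integrable_exp_mismatch_prod hg h01 hα a b).integral_prod_left,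
   (integrable_exp_mismatch_prod hg h01 hα b a).integral_prod_left⟩

theorem integral_exp_mul_mismatch (hg : Measurable g) (h01 : ∀ y, g y = 0 ∨ g y = 1)
    (hα : 0 < α) (hL : 0 ≤ L) :
    ∫ z in Set.Ioi (0 : ℝ), Real.exp (-α * z) * mismatch g L z =
      ∫ y in (0 : ℝ)..L, expMismatch g α y := by
  rw [intervalIntegral.integral_of_le hL]
  unfold expMismatch
  rw [integral_integral_swap (integrable_exp_mismatch_prod hg h01 hα 0 L)]
  refine setIntegral_congr_fun measurableSet_Ioi fun z _ => ?_
  simp only [mismatch]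
  rw [intervalIntegral.integral_of_le hL, integral_const_mul]

theorem integral_exp_reflect (hα : 0 < α) (a b : ℝ) :
    ∫ y in a..b, Real.exp (-α * (b - y)) = (1 - Real.exp (-α * (b - a))) / α := by
  have h : ∀ y ∈ Set.uIcc a b, HasDerivAt (fun y => Real.exp (-α * (b - y)) / α)
      (Real.exp (-α * (b - y))) y := by
    intro y _
    have h1 : HasDerivAt (fun y : ℝ => -α * (b - y)) α y := by
      simpa using ((hasDerivAt_id y).const_sub b).const_mul (-α)
    have := (h1.exp).div_const α
    rwa [mul_div_cancel_right₀ _ hα.ne'] at this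
  rw [intervalIntegral.integral_eq_sub_of_hasDerivAt h
    (Continuous.intervalIntegrable (by fun_prop) _ _)]
  simp; ring

end

namespace IsJumpProfile

variable {g : ℝ → ℝ} {L α : ℝ} {N : ℕ} {x : ℕ → ℝ}

theorem expMismatch_add_period (h : IsJumpProfile g L N x) (y : ℝ) :
    expMismatch g α (y + L) = expMismatch g α y := by
  unfold expMismatch
  refine setIntegral_congr_fun measurableSet_Ioi fun w _ => ?_
  rw [h.periodic y, show y + L + w = y + w + L by ring, h.periodic (y + w)]

theorem expMismatch_on_gap (h : IsJumpProfile g L N x) (hα : 0 < α) {i : ℕ} (hi : i < N) {y : ℝ}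
    (hy : y ∈ Set.Ico (x i) (x (i + 1))) :
    expMismatch g α y =
      Real.exp (-α * (x (i + 1) - y)) * (1 / α - expMismatch g α (x (i + 1))) := by
  have := expMismatch_eq h.measurable h.zero_or_one hα (y := y) (ℓ := x (i + 1) - y)
    (by linarith [hy.2]) (fun w hw => by
      rw [h.const i hi y hy, h.const i hi w ⟨hy.1.trans hw.1, by linarith [hw.2]⟩])
    (by rw [add_sub_cancel, h.flip i hi, h.const i hi y hy])
  rwa [add_sub_cancel] at this

theorem integral_exp_mul_mismatch_eq (h : IsJumpProfile g L N x) (hα : 0 < α) (hL : 0 ≤ L) :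
    ∫ z in Set.Ioi (0 : ℝ), Real.exp (-α * z) * mismatch g L z =
      1 / α ^ 2 * ∑ i ∈ Finset.range N, (1 - Real.exp (-α * (x (i + 1) - x i))) *
        (1 - α * expMismatch g α (x (i + 1))) := by
  rw [integral_exp_mul_mismatch h.measurable h.zero_or_one hα hL]
  have hp : Function.Periodic (expMismatch g α) L := h.expMismatch_add_period
  have := hp.intervalIntegral_add_eq 0 (x 0)
  rw [zero_add] at this
  rw [this, ← h.wrap, ← intervalIntegral.sum_integral_adjacent_intervals
    (fun i _ => intervalIntegrable_expMismatch h.measurable h.zero_or_one hα _ _), Finset.mul_sum]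
  refine Finset.sum_congr rfl fun i hi => ?_
  have hi := Finset.mem_range.1 hi
  have e : ∫ y in x i..x (i + 1), expMismatch g α y = ∫ y in x i..x (i + 1),
      Real.exp (-α * (x (i + 1) - y)) * (1 / α - expMismatch g α (x (i + 1))) := by
    rw [intervalIntegral.integral_of_le (h.lt i hi).le,
      intervalIntegral.integral_of_le (h.lt i hi).le, integral_Ioc_eq_integral_Ioo,
      integral_Ioc_eq_integral_Ioo]
    exact setIntegral_congr_fun measurableSet_Ioo fun y hy =>
      h.expMismatch_on_gap hα hi ⟨hy.1.le, hy.2⟩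
  rw [e, intervalIntegral.integral_mul_const, integral_exp_reflect hα]
  field_simp

/-- The recursion `U i = 1 - q i * U (i + 1)` to which `cyclic_sum_le` applies. -/
theorem one_sub_expMismatch (h : IsJumpProfile g L N x) (hα : 0 < α) {i : ℕ} (hi : i < N) :
    1 - α * expMismatch g α (x i) = 1 - Real.exp (-α * (x (i + 1) - x i)) *
      (1 - α * expMismatch g α (x (i + 1))) := by
  rw [h.expMismatch_on_gap hα hi ⟨le_rfl, h.lt i hi⟩]
  field_simp

theorem integral_exp_mul_mismatch_le (h : IsJumpProfile g L N x) (hα : 0 < α) (hL : 0 ≤ L) :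
    ∫ z in Set.Ioi (0 : ℝ), Real.exp (-α * z) * mismatch g L z ≤
      1 / α ^ 2 * ∑ i ∈ Finset.range N, (1 - Real.exp (-α * (x (i + 1) - x i))) /
        (1 + Real.exp (-α * (x (i + 1) - x i))) := by
  rw [h.integral_exp_mul_mismatch_eq hα hL]
  refine mul_le_mul_of_nonneg_left ?_ (by positivity)
  refine cyclic_sum_le (q := fun i => Real.exp (-α * (x (i + 1) - x i)))
    (U := fun i => 1 - α * expMismatch g α (x i)) (fun i _ => (Real.exp_pos _).le)
    (fun i hi => ?_) ?_ fun i hi => h.one_sub_expMismatch hα hi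
  · rw [Real.exp_le_one_iff]
    nlinarith [h.lt i hi]
  · rw [h.wrap, h.expMismatch_add_period]

theorem integral_exp_mul_mismatch_eq_of_gap (h : IsJumpProfile g L N x) (hα : 0 < α) (hL : 0 ≤ L)
    {ℓ : ℝ} (hgap : ∀ i < N, x (i + 1) - x i = ℓ) :
    ∫ z in Set.Ioi (0 : ℝ), Real.exp (-α * z) * mismatch g L z =
      1 / α ^ 2 * ∑ _i ∈ Finset.range N, (1 - Real.exp (-α * ℓ)) / (1 + Real.exp (-α * ℓ)) := by
  rw [h.integral_exp_mul_mismatch_eq hα hL]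
  congr 1
  rw [← cyclic_sum_eq (r := Real.exp (-α * ℓ)) (U := fun i => 1 - α * expMismatch g α (x i))
    (Real.exp_pos _).le ?_ fun i hi => ?_]
  · refine Finset.sum_congr rfl fun i hi => ?_
    rw [hgap i (Finset.mem_range.1 hi)]
  · rw [h.wrap, h.expMismatch_add_period]
  · rw [h.one_sub_expMismatch hα hi, hgap i hi]

end IsJumpProfile

/-! ### Superposition of exponentials -/

section

variable {g : ℝ → ℝ} {L α : ℝ}

theorem intervalIntegrable_abs_sub (hg : Measurable g) (h01 : ∀ y, g y = 0 ∨ g y = 1)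
    (z a b : ℝ) : IntervalIntegrable (fun y => |g y - g (y + z)|) volume a b := by
  have : ∀ a b : ℝ, IntegrableOn (fun y => |g y - g (y + z)|) (Set.Ioc a b) := fun a b =>
    Measure.integrableOn_of_bounded (M := 1) (by simp) (by fun_prop)
      (Eventually.of_forall fun y => by simpa using abs_sub_le_one h01 _ _)
  exact ⟨this a b, this b a⟩

theorem mismatch_nonneg (hL : 0 ≤ L) (z : ℝ) : 0 ≤ mismatch g L z :=
  intervalIntegral.integral_nonneg hL fun _ _ => abs_nonneg _

theorem mismatch_le (hg : Measurable g) (h01 : ∀ y, g y = 0 ∨ g y = 1) (hL : 0 ≤ L) (z : ℝ) :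
    mismatch g L z ≤ L := by
  have := intervalIntegral.integral_mono_on hL (intervalIntegrable_abs_sub hg h01 z 0 L)
    (intervalIntegrable_const (c := (1 : ℝ))) fun y _ => abs_sub_le_one h01 y (y + z)
  simpa [mismatch] using this

theorem mismatch_neg (hp : Function.Periodic g L) (z : ℝ) :
    mismatch g L (-z) = mismatch g L z := by
  have hp' : Function.Periodic (fun y => |g y - g (y + -z)|) L := fun y => by
    simp only []
    rw [hp y, show y + L + -z = y + -z + L by ring, hp]
  have h1 := hp'.intervalIntegral_add_eq 0 z
  have h2 := intervalIntegral.integral_comp_add_right (a := 0) (b := L)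
    (fun y => |g y - g (y + -z)|) z
  rw [zero_add] at h1 h2
  rw [mismatch, h1, add_comm z L, ← h2, mismatch]
  refine intervalIntegral.integral_congr fun y _ => ?_
  rw [abs_sub_comm, add_neg_cancel_right]

theorem mismatch_abs (hp : Function.Periodic g L) (z : ℝ) :
    mismatch g L |z| = mismatch g L z := by
  rcases abs_choice z with h | h <;> rw [h]
  exact mismatch_neg hp z

theorem measurable_mismatch (hg : Measurable g) : Measurable (mismatch g L) := by
  have : ∀ a b : ℝ, Measurable fun z => ∫ y in Set.Ioc a b, |g y - g (y + z)| := fun a b => by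
    refine (StronglyMeasurable.integral_prod_right
      (f := fun z y => |g y - g (y + z)|) ?_).measurable
    exact Measurable.stronglyMeasurable (by unfold Function.uncurry; fun_prop)
  exact (this 0 L).sub (this L 0)

end

namespace IsJumpProfile

variable {g : ℝ → ℝ} {L α δ : ℝ} {N : ℕ} {x : ℕ → ℝ}

theorem eq_near_jump (h : IsJumpProfile g L N x) (hδ : ∀ i < N, δ ≤ x (i + 1) - x i)
    {i : ℕ} (hi : i < N) {y : ℝ} (hy : y ∈ Set.Ico (x (i + 1)) (x (i + 1) + δ)) :
    g y = g (x (i + 1)) := by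
  rcases Nat.lt_or_ge (i + 1) N with h1 | h1
  · exact h.const (i + 1) h1 y ⟨hy.1, by linarith [hy.2, hδ _ h1]⟩
  · have hN : i + 1 = N := le_antisymm hi h1
    have h0 : 0 < N := by omega
    rw [hN, h.wrap] at hy ⊢
    have := h.const 0 h0 (y - L) ⟨by linarith [hy.1], by linarith [hy.2, hδ 0 h0]⟩
    rw [h.periodic, ← this, h.periodic.sub_eq]

/-- For small shifts every jump contributes a mismatch of length `z`. Hence
`N * |z| - mismatch g L z` vanishes near `z = 0`, where the kernel may be singular. -/
theorem mismatch_eq (h : IsJumpProfile g L N x) (hδ : ∀ i < N, δ ≤ x (i + 1) - x i)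
    {z : ℝ} (hz0 : 0 ≤ z) (hz : z ≤ δ) : mismatch g L z = N * z := by
  have hp' : Function.Periodic (fun y => |g y - g (y + z)|) L := fun y => by
    simp only []
    rw [h.periodic y, show y + L + z = y + z + L by ring, h.periodic]
  have h1 := hp'.intervalIntegral_add_eq 0 (x 0)
  rw [zero_add, ← h.wrap] at h1
  rw [mismatch, h1, ← intervalIntegral.sum_integral_adjacent_intervals
    (fun i _ => intervalIntegrable_abs_sub h.measurable h.zero_or_one z _ _)]
  have key : ∀ i ∈ Finset.range N, ∫ y in x i..x (i + 1), |g y - g (y + z)| = z := by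
    intro i hi
    have hi := Finset.mem_range.1 hi
    have hii := intervalIntegrable_abs_sub h.measurable h.zero_or_one z
    have hgap := hδ i hi
    have left : ∫ y in x i..x (i + 1) - z, |g y - g (y + z)| = 0 := by
      rw [intervalIntegral.integral_congr_Ioo_of_le (g := fun _ => (0 : ℝ)) (by linarith)
        fun y hy => ?_]
      · simp
      · have e1 := h.const i hi y ⟨hy.1.le, by linarith [hy.2]⟩
        have e2 := h.const i hi (y + z) ⟨by linarith [hy.1], by linarith [hy.2]⟩
        simp [e1, e2]
    have right : ∫ y in x (i + 1) - z..x (i + 1), |g y - g (y + z)| = z := by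
      rw [intervalIntegral.integral_congr_Ioo_of_le (g := fun _ => (1 : ℝ)) (by linarith)
        fun y hy => ?_]
      · simp
      · have e1 := h.const i hi y ⟨by linarith [hy.1], hy.2⟩
        have e2 := h.eq_near_jump hδ hi (y := y + z) ⟨by linarith [hy.1], by linarith [hy.2]⟩
        simp only []
        rw [e1, e2, h.flip i hi]
        rcases h.zero_or_one (x i) with h' | h' <;> simp [h']
    rw [← intervalIntegral.integral_add_adjacent_intervals (hii (x i) (x (i + 1) - z))
      (hii (x (i + 1) - z) (x (i + 1))), left, right, zero_add]
  rw [Finset.sum_congr rfl key]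
  simp

end IsJumpProfile

theorem integral_exp_mul_id {α : ℝ} (hα : 0 < α) :
    ∫ z in Set.Ioi (0 : ℝ), Real.exp (-α * z) * z = 1 / α ^ 2 := by
  have := Real.integral_rpow_mul_exp_neg_mul_Ioi (a := 2) (by norm_num) hα
  rw [Real.Gamma_two, mul_one, show (2 : ℝ) - 1 = 1 by norm_num] at this
  rw [show (1 : ℝ) / α ^ 2 = (1 / α) ^ (2 : ℝ) by rw [Real.rpow_two]; ring, ← this]
  refine setIntegral_congr_fun measurableSet_Ioi fun z _ => ?_
  simp only [Real.rpow_one]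
  rw [mul_comm, neg_mul]

theorem integrableOn_exp_mul_id {α : ℝ} (hα : 0 < α) :
    IntegrableOn (fun z => Real.exp (-α * z) * z) (Set.Ioi 0) :=
  .of_integral_ne_zero (by rw [integral_exp_mul_id hα]; positivity)

/-- `k` is, off the origin, the Laplace transform of `f ≥ 0` as a function of `|z|`, and decays
like `c |z| ^ (-q)`. The value `k 0` is irrelevant. -/
structure IsLaplaceKernel (f k : ℝ → ℝ) (c q : ℝ) : Prop where
  measurable : Measurable f
  nonneg : ∀ α, 0 ≤ f α
  integrableOn : ∀ z : ℝ, z ≠ 0 →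
    IntegrableOn (fun α => f α * Real.exp (-α * |z|)) (Set.Ioi 0)
  eq : ∀ z : ℝ, z ≠ 0 → k z = ∫ α in Set.Ioi (0 : ℝ), f α * Real.exp (-α * |z|)
  le : ∀ z : ℝ, z ≠ 0 → k z ≤ c * |z| ^ (-q)
  three_le : 3 ≤ q

/-- The nonlocal energy per boundary point of stripes of width `h`, for the kernel `exp (-α|z|)`. -/
def stripeWeight (h α : ℝ) : ℝ := 4 / (α ^ 2 * (1 + Real.exp (α * h)))

/-- The nonlocal energy per boundary point of stripes of width `h`, for the kernel which is the
Laplace transform of `f`. -/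
def stripePotential (f : ℝ → ℝ) (h : ℝ) : ℝ :=
  ∫ α in Set.Ioi (0 : ℝ), f α * stripeWeight h α

theorem integrable_rpow_indicator {q δ : ℝ} (hq : 3 ≤ q) (hδ : 0 < δ) :
    Integrable fun z : ℝ => {z : ℝ | δ ≤ |z|}.indicator (fun z => |z| ^ (1 - q)) z := by
  have h1 : Integrable fun z : ℝ => (1 + 1 / δ) ^ (q - 1) * (1 + ‖z‖) ^ (-(q - 1)) :=
    (integrable_one_add_norm (by simp; linarith)).const_mul _
  refine h1.mono' ?_ (Eventually.of_forall fun z => ?_)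
  · refine (Measurable.indicator ?_ ?_).aestronglyMeasurable
    · fun_prop
    · exact measurableSet_le (by fun_prop) (by fun_prop)
  · by_cases hz : δ ≤ |z|
    · have hz0 : 0 < |z| := hδ.trans_le hz
      rw [Set.indicator_of_mem (by exact hz), Real.norm_eq_abs,
        abs_of_nonneg (Real.rpow_nonneg hz0.le _), Real.norm_eq_abs, Real.rpow_neg (by positivity),
        show 1 - q = -(q - 1) by ring, Real.rpow_neg hz0.le,
        ← div_eq_mul_inv, ← Real.div_rpow (by positivity) (by positivity),
        ← Real.inv_rpow hz0.le]
      refine Real.rpow_le_rpow (by positivity) ?_ (by linarith)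
      rw [inv_eq_one_div, div_le_div_iff₀ hz0 (by positivity)]
      have : 1 ≤ 1 / δ * |z| := by
        rw [one_div, ← div_eq_inv_mul, le_div_iff₀ hδ]; linarith
      linarith
    · rw [Set.indicator_of_notMem (by exact hz), norm_zero]
      positivity

namespace IsLaplaceKernel

variable {f k : ℝ → ℝ} {c q : ℝ}

theorem kernel_nonneg (hk : IsLaplaceKernel f k c q) {z : ℝ} (hz : z ≠ 0) : 0 ≤ k z := by
  rw [hk.eq z hz]
  exact integral_nonneg fun α => mul_nonneg (hk.nonneg α) (Real.exp_pos _).le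

theorem aestronglyMeasurable (hk : IsLaplaceKernel f k c q) : AEStronglyMeasurable k := by
  have hm := hk.measurable
  have : StronglyMeasurable fun z : ℝ =>
      ∫ α in Set.Ioi (0 : ℝ), f α * Real.exp (-α * |z|) := by
    refine StronglyMeasurable.integral_prod_right (f := fun z α => f α * Real.exp (-α * |z|)) ?_
    exact Measurable.stronglyMeasurable (by unfold Function.uncurry; fun_prop)
  refine this.aestronglyMeasurable.congr ?_
  filter_upwards [volume.ae_ne 0] with z hz
  exact (hk.eq z hz).symm

/-- The kernel may be tested against functions which vanish near the origin and grow at most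
linearly. -/
theorem integrable_kernel_mul (hk : IsLaplaceKernel f k c q) {B : ℝ → ℝ} (hB : Measurable B)
    {δ M : ℝ} (hδ : 0 < δ) (hB0 : ∀ z, |z| < δ → B z = 0) (hBM : ∀ z, |B z| ≤ M * |z|) :
    Integrable fun z => k z * B z := by
  refine ((integrable_rpow_indicator hk.three_le hδ).const_mul (c * M)).mono'
    (hk.aestronglyMeasurable.mul hB.aestronglyMeasurable) ?_
  filter_upwards [volume.ae_ne 0] with z hz
  by_cases h : δ ≤ |z|
  · have hz0 : 0 < |z| := hδ.trans_le h
    rw [Set.indicator_of_mem (by exact h), norm_mul, Real.norm_eq_abs, Real.norm_eq_abs,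
      abs_of_nonneg (hk.kernel_nonneg hz)]
    calc k z * |B z| ≤ (c * |z| ^ (-q)) * (M * |z|) :=
          mul_le_mul (hk.le z hz) (hBM z) (abs_nonneg _) ((hk.kernel_nonneg hz).trans (hk.le z hz))
      _ = c * M * (|z| ^ (-q) * |z| ^ (1 : ℝ)) := by rw [Real.rpow_one]; ring
      _ = c * M * |z| ^ (1 - q) := by rw [← Real.rpow_add hz0]; ring_nf
  · rw [hB0 z (not_le.1 h), Set.indicator_of_notMem (by exact h)]; simp

theorem integrable_prod (hk : IsLaplaceKernel f k c q) {B : ℝ → ℝ} (hB : Measurable B)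
    {δ M : ℝ} (hδ : 0 < δ) (hB0 : ∀ z, |z| < δ → B z = 0) (hBM : ∀ z, |B z| ≤ M * |z|) :
    Integrable (fun v : ℝ × ℝ => f v.2 * Real.exp (-v.2 * |v.1|) * B v.1)
      (volume.prod (volume.restrict (Set.Ioi 0))) := by
  have hm := hk.measurable
  rw [integrable_prod_iff (Measurable.aestronglyMeasurable (by fun_prop))]
  constructor
  · filter_upwards [volume.ae_ne 0] with z hz
    exact (hk.integrableOn z hz).mul_const _
  · refine (hk.integrable_kernel_mul hB hδ hB0 hBM).norm.congr ?_
    filter_upwards [volume.ae_ne 0] with z hz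
    rw [norm_mul, Real.norm_of_nonneg (hk.kernel_nonneg hz), hk.eq z hz, ← integral_mul_const]
    refine integral_congr_ae (Eventually.of_forall fun α => ?_)
    simp only []
    rw [norm_mul, Real.norm_of_nonneg (mul_nonneg (hk.nonneg α) (Real.exp_pos _).le)]

/-- Fubini's theorem for the representation of the kernel by exponentials. -/
theorem integral_kernel_mul (hk : IsLaplaceKernel f k c q) {B : ℝ → ℝ} (hB : Measurable B)
    {δ M : ℝ} (hδ : 0 < δ) (hB0 : ∀ z, |z| < δ → B z = 0) (hBM : ∀ z, |B z| ≤ M * |z|) :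
    IntegrableOn (fun α => f α * ∫ z, Real.exp (-α * |z|) * B z) (Set.Ioi 0) ∧
    ∫ z, k z * B z = ∫ α in Set.Ioi (0 : ℝ), f α * ∫ z, Real.exp (-α * |z|) * B z := by
  have h := hk.integrable_prod hB hδ hB0 hBM
  have e : ∀ α, ∫ z, f α * Real.exp (-α * |z|) * B z = f α * ∫ z, Real.exp (-α * |z|) * B z := by
    intro α
    rw [← integral_const_mul]
    simp only [mul_assoc]
  constructor
  · refine h.integral_prod_right.congr (Eventually.of_forall fun α => ?_)
    exact e α
  · simp only [← e]
    rw [← integral_integral_swap h]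
    refine integral_congr_ae ?_
    filter_upwards [volume.ae_ne 0] with z hz
    rw [hk.eq z hz, integral_mul_const]

end IsLaplaceKernel

theorem two_mul_sub_sum_eq {α : ℝ} (hα : 0 < α) {N : ℕ} (ℓ : ℕ → ℝ) :
    2 * (N * (1 / α ^ 2) - 1 / α ^ 2 * ∑ i ∈ Finset.range N,
      (1 - Real.exp (-α * ℓ i)) / (1 + Real.exp (-α * ℓ i))) =
      ∑ i ∈ Finset.range N, stripeWeight (ℓ i) α := by
  have : (N : ℝ) = ∑ _i ∈ Finset.range N, (1 : ℝ) := by simp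
  rw [this, Finset.sum_mul, Finset.mul_sum, ← Finset.sum_sub_distrib, Finset.mul_sum]
  refine Finset.sum_congr rfl fun i _ => ?_
  have h1 : Real.exp (-α * ℓ i) = (Real.exp (α * ℓ i))⁻¹ := by
    rw [← Real.exp_neg]; ring_nf
  have h2 := Real.exp_pos (α * ℓ i)
  rw [h1, stripeWeight]
  have h3 : 1 + (Real.exp (α * ℓ i))⁻¹ ≠ 0 := by positivity
  have h4 : 1 + Real.exp (α * ℓ i) ≠ 0 := by positivity
  field_simp
  ring

namespace IsJumpProfile

variable {g f k : ℝ → ℝ} {L α δ c q : ℝ} {N : ℕ} {x : ℕ → ℝ}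

theorem exists_gap (h : IsJumpProfile g L N x) : ∃ δ > 0, ∀ i < N, δ ≤ x (i + 1) - x i := by
  rcases N.eq_zero_or_pos with hN | hN
  · exact ⟨1, one_pos, by simp [hN]⟩
  · obtain ⟨j, hj, hj'⟩ := Finset.exists_min_image (Finset.range N) (fun i => x (i + 1) - x i)
      ⟨0, Finset.mem_range.2 hN⟩
    exact ⟨x (j + 1) - x j, sub_pos.2 (h.lt j (Finset.mem_range.1 hj)),
      fun i hi => hj' i (Finset.mem_range.2 hi)⟩

theorem excess_eq_zero (h : IsJumpProfile g L N x) (hδ : ∀ i < N, δ ≤ x (i + 1) - x i)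
    {z : ℝ} (hz : |z| ≤ δ) : N * |z| - mismatch g L z = 0 := by
  rw [← mismatch_abs h.periodic, h.mismatch_eq hδ (abs_nonneg z) hz, sub_self]

theorem abs_excess_le (h : IsJumpProfile g L N x) (hL : 0 ≤ L) (hδ0 : 0 < δ)
    (hδ : ∀ i < N, δ ≤ x (i + 1) - x i) (z : ℝ) :
    |N * |z| - mismatch g L z| ≤ (N + L / δ) * |z| := by
  rcases le_total |z| δ with hz | hz
  · rw [h.excess_eq_zero hδ hz, abs_zero]; positivity
  · have h1 := mismatch_nonneg (g := g) hL z
    have h2 := mismatch_le h.measurable h.zero_or_one hL z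
    have h3 : L ≤ L / δ * |z| := by
      rw [div_mul_eq_mul_div, le_div_iff₀ hδ0]; gcongr
    have h4 : 0 ≤ N * |z| := by positivity
    rw [abs_le]; constructor <;> nlinarith

theorem measurable_excess (h : IsJumpProfile g L N x) :
    Measurable fun z => N * |z| - mismatch g L z := by
  have := measurable_mismatch (L := L) h.measurable
  fun_prop

theorem integral_exp_mul_excess (h : IsJumpProfile g L N x) (hα : 0 < α) (hL : 0 ≤ L) :
    ∫ z, Real.exp (-α * |z|) * (N * |z| - mismatch g L z) =
      2 * (N * (1 / α ^ 2) - ∫ z in Set.Ioi (0 : ℝ), Real.exp (-α * z) * mismatch g L z) := by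
  have e1 : ∫ z, Real.exp (-α * |z|) * (N * |z| - mismatch g L z) =
      ∫ z, (fun z => Real.exp (-α * z) * (N * z - mismatch g L z)) |z| := by
    simp only [mismatch_abs h.periodic]
  have hi : IntegrableOn (fun z => Real.exp (-α * z) * mismatch g L z) (Set.Ioi 0) := by
    refine (integrableOn_exp_neg hα).mul_bdd (c := L)
      (measurable_mismatch h.measurable).aestronglyMeasurable (Eventually.of_forall fun z => ?_)
    rw [Real.norm_of_nonneg (mismatch_nonneg hL z)]
    exact mismatch_le h.measurable h.zero_or_one hL z
  have e2 := integral_comp_abs (f := fun z => Real.exp (-α * z) * (N * z - mismatch g L z))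
  rw [e1, e2, ← integral_exp_mul_id hα, ← integral_const_mul (N : ℝ),
    ← integral_sub ((integrableOn_exp_mul_id hα).const_mul _) hi]
  congr 1
  refine integral_congr_ae (Eventually.of_forall fun z => ?_)
  simp only []
  ring

/-- Equality holds in the lower bound if all gaps are equal. -/
theorem integrableOn_and_integral_of_gap (h : IsJumpProfile g L N x)
    (hk : IsLaplaceKernel f k c q) (hL : 0 ≤ L) {ℓ : ℝ} (hgap : ∀ i < N, x (i + 1) - x i = ℓ) :
    IntegrableOn (fun α => f α * (N * stripeWeight ℓ α)) (Set.Ioi 0) ∧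
    ∫ z, k z * (N * |z| - mismatch g L z) = N * stripePotential f ℓ := by
  obtain ⟨δ, hδ0, hδ⟩ := h.exists_gap
  have H := hk.integral_kernel_mul h.measurable_excess hδ0
    (fun z hz => h.excess_eq_zero hδ hz.le) (h.abs_excess_le hL hδ0 hδ)
  have e : ∀ α ∈ Set.Ioi (0 : ℝ), f α * ∫ z, Real.exp (-α * |z|) * (N * |z| - mismatch g L z) =
      f α * (N * stripeWeight ℓ α) := by
    intro α hα
    rw [h.integral_exp_mul_excess hα hL, h.integral_exp_mul_mismatch_eq_of_gap hα hL hgap,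
      two_mul_sub_sum_eq hα fun _ => ℓ]
    simp
  refine ⟨H.1.congr_fun e measurableSet_Ioi, ?_⟩
  rw [H.2, setIntegral_congr_fun measurableSet_Ioi e, stripePotential, ← integral_const_mul]
  refine integral_congr_ae (Eventually.of_forall fun z => ?_)
  simp only []
  ring

/-- The lower bound: each gap contributes at least as much as it would in stripes of its width. -/
theorem sum_stripePotential_le (h : IsJumpProfile g L N x)
    (hk : IsLaplaceKernel f k c q) (hL : 0 ≤ L)
    (hint : ∀ ℓ : ℝ, 0 < ℓ → IntegrableOn (fun α => f α * stripeWeight ℓ α) (Set.Ioi 0)) :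
    ∑ i ∈ Finset.range N, stripePotential f (x (i + 1) - x i) ≤
      ∫ z, k z * (N * |z| - mismatch g L z) := by
  obtain ⟨δ, hδ0, hδ⟩ := h.exists_gap
  have H := hk.integral_kernel_mul h.measurable_excess hδ0
    (fun z hz => h.excess_eq_zero hδ hz.le) (h.abs_excess_le hL hδ0 hδ)
  have hi : ∀ i ∈ Finset.range N,
      IntegrableOn (fun α => f α * stripeWeight (x (i + 1) - x i) α) (Set.Ioi 0) := fun i hi =>
    hint _ (sub_pos.2 (h.lt i (Finset.mem_range.1 hi)))
  rw [H.2]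
  unfold stripePotential
  rw [← integral_finsetSum _ hi]
  refine setIntegral_mono_on (integrable_finsetSum _ hi) H.1 measurableSet_Ioi fun α hα => ?_
  rw [← Finset.mul_sum]
  refine mul_le_mul_of_nonneg_left ?_ (hk.nonneg α)
  rw [h.integral_exp_mul_excess hα hL, ← two_mul_sub_sum_eq hα fun i => x (i + 1) - x i]
  have := h.integral_exp_mul_mismatch_le hα hL
  linarith

end IsJumpProfile

/-! ### Stripes and their interaction energy -/

/-- The right-continuous representative of the characteristic function of `⋃ k, [2kh, (2k+1)h)`. -/
def stripeProfile (h y : ℝ) : ℝ := if Even ⌊y / h⌋ then 1 else 0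

theorem stripeProfile_of_mem {h y : ℝ} (hh : 0 < h) {n : ℤ} (hy : y ∈ Set.Ico (n * h) ((n + 1) * h)) :
    stripeProfile h y = if Even n then 1 else 0 := by
  have : ⌊y / h⌋ = n := by
    rw [Int.floor_eq_iff, le_div_iff₀ hh, div_lt_iff₀ hh]
    exact hy
  rw [stripeProfile, this]

theorem isJumpProfile_stripeProfile {h : ℝ} (hh : 0 < h) (M : ℕ) :
    IsJumpProfile (stripeProfile h) (2 * M * h) (2 * M) fun i => i * h where
  measurable := by
    have h1 : Measurable fun n : ℤ => if Even n then (1 : ℝ) else 0 := measurable_from_top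
    exact h1.comp (Int.measurable_floor.comp (measurable_id.div_const h))
  zero_or_one y := by
    unfold stripeProfile; split_ifs <;> simp
  periodic y := by
    have : (y + 2 * M * h) / h = y / h + ((2 * M : ℤ) : ℝ) := by
      push_cast; field_simp
    rw [stripeProfile, stripeProfile, this, Int.floor_add_intCast]
    simp [Int.even_add]
  lt i _ := by push_cast; nlinarith
  const i _ y hy := by
    push_cast at hy
    rw [stripeProfile_of_mem hh (n := i) (by push_cast; exact hy),
      stripeProfile_of_mem hh (n := i) (by push_cast; constructor <;> nlinarith)]
  flip i _ := by
    rw [stripeProfile_of_mem hh (n := i + 1) (by push_cast; constructor <;> nlinarith),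
      stripeProfile_of_mem hh (n := i) (by push_cast; constructor <;> nlinarith)]
    rcases Int.even_or_odd (i : ℤ) with hi | hi
    · have : ¬ Even ((i : ℤ) + 1) := by rw [Int.not_even_iff_odd]; exact hi.add_one
      simp [hi, this]
    · have h1 : ¬ Even (i : ℤ) := by rwa [Int.not_even_iff_odd]
      have h2 : Even ((i : ℤ) + 1) := hi.add_one
      rw [if_pos h2, if_neg h1, sub_zero]
  wrap := by simp

theorem strictConvexOn_inv_one_add_exp :
    StrictConvexOn ℝ (Set.Ioi 0) fun y : ℝ => 1 / (1 + Real.exp y) := by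
  have hd : ∀ y : ℝ, HasDerivAt (fun y : ℝ => 1 / (1 + Real.exp y))
      (-(1 / (2 + 2 * Real.cosh y))) y := by
    intro y
    have h0 : 1 + Real.exp y ≠ 0 := by positivity
    have h1 := ((Real.hasDerivAt_exp y).const_add 1).fun_inv h0
    have h2 : -(1 / (2 + 2 * Real.cosh y)) = -Real.exp y / (1 + Real.exp y) ^ 2 := by
      rw [Real.cosh_eq, Real.exp_neg]
      have := Real.exp_pos y
      field_simp
      ring
    rw [h2]
    simpa only [one_div] using h1
  refine StrictMonoOn.strictConvexOn_of_deriv (convex_Ioi 0)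
    (fun y _ => (hd y).continuousAt.continuousWithinAt) ?_
  rw [interior_Ioi]
  intro a ha b hb hab
  rw [(hd a).deriv, (hd b).deriv]
  have h1 := Real.cosh_strictMonoOn (Set.Ioi_subset_Ici_self ha) (Set.Ioi_subset_Ici_self hb) hab
  have h2 := Real.cosh_pos a
  rw [neg_lt_neg_iff]
  gcongr

section

variable {α h : ℝ}

theorem stripeWeight_nonneg (h α : ℝ) : 0 ≤ stripeWeight h α := by
  unfold stripeWeight; positivity

theorem stripeWeight_lt (hα : 0 < α) {x y a b : ℝ} (hx : 0 < x) (hy : 0 < y) (hxy : x ≠ y)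
    (ha : 0 < a) (hb : 0 < b) (hab : a + b = 1) :
    stripeWeight (a * x + b * y) α < a * stripeWeight x α + b * stripeWeight y α := by
  have h1 := strictConvexOn_inv_one_add_exp.2 (x := α * x) (y := α * y)
    (mul_pos hα hx) (mul_pos hα hy) (fun h => hxy (mul_left_cancel₀ hα.ne' h)) ha hb hab
  have e : ∀ t, stripeWeight t α = 4 / α ^ 2 * (1 / (1 + Real.exp (α * t))) := fun t => by
    rw [stripeWeight, div_mul_div_comm, mul_one]
  rw [e, e, e, mul_left_comm a, mul_left_comm b, ← mul_add]
  refine mul_lt_mul_of_pos_left ?_ (by positivity)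
  rw [show α * (a * x + b * y) = a * (α * x) + b * (α * y) by ring]
  simpa only [smul_eq_mul] using h1

theorem le_stripeWeight (hα : 0 < α) (hh : 0 < h) :
    h ^ 2 * Real.exp (-α * (2 * h)) ≤ stripeWeight h α := by
  have h1 : (α * h) ^ 2 ≤ Real.exp (α * h) * 2 := by
    have := Real.quadratic_le_exp_of_nonneg (x := α * h) (by positivity)
    have : 0 < α * h := by positivity
    linarith
  have h2 : 1 ≤ Real.exp (α * h) := Real.one_le_exp (by positivity)
  have h3 : Real.exp (-α * (2 * h)) = (Real.exp (α * h) ^ 2)⁻¹ := by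
    rw [← Real.exp_nat_mul, ← Real.exp_neg]; congr 1; push_cast; ring
  have h4 : α ^ 2 * h ^ 2 ≤ 2 * Real.exp (α * h) := by nlinarith
  rw [h3, stripeWeight, ← div_eq_mul_inv, div_le_div_iff₀ (by positivity) (by positivity)]
  calc h ^ 2 * (α ^ 2 * (1 + Real.exp (α * h)))
      = (α ^ 2 * h ^ 2) * (1 + Real.exp (α * h)) := by ring
    _ ≤ (2 * Real.exp (α * h)) * (2 * Real.exp (α * h)) := by
        gcongr; linarith
    _ = 4 * Real.exp (α * h) ^ 2 := by ring

theorem stripeWeight_anti (hα : 0 ≤ α) {x y : ℝ} (hxy : x ≤ y) :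
    stripeWeight y α ≤ stripeWeight x α := by
  rcases hα.eq_or_lt with rfl | hα
  · simp [stripeWeight]
  · unfold stripeWeight; gcongr

end

theorem integral_sq_inv_indicator {h : ℝ} (hh : 0 < h) :
    ∫ z : ℝ, {z : ℝ | h ≤ |z|}.indicator (fun z => |z| ^ (1 - 3 : ℝ)) z = 2 / h := by
  have e : ∀ z : ℝ, {z : ℝ | h ≤ |z|}.indicator (fun z => |z| ^ (1 - 3 : ℝ)) z =
      (fun t : ℝ => (Set.Ici h).indicator (fun t => t ^ (-2 : ℝ)) t) |z| := by
    intro z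
    by_cases hz : h ≤ |z|
    · simp only []
      rw [Set.indicator_of_mem (by exact hz), Set.indicator_of_mem (by exact hz)]
      norm_num
    · simp only []
      rw [Set.indicator_of_notMem (by exact hz), Set.indicator_of_notMem (by exact hz)]
  simp only [e]
  have e2 := integral_comp_abs (f := fun t : ℝ => (Set.Ici h).indicator (fun t => t ^ (-2 : ℝ)) t)
  rw [e2, setIntegral_indicator measurableSet_Ici,
    Set.inter_eq_right.2 (Set.Ici_subset_Ioi.2 hh), integral_Ici_eq_integral_Ioi,
    integral_Ioi_rpow_of_lt (by norm_num) hh]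
  norm_num
  rw [Real.rpow_neg_one]
  rfl

namespace IsLaplaceKernel

variable {f k : ℝ → ℝ} {c q : ℝ}

theorem integrableOn_mul_stripeWeight (hk : IsLaplaceKernel f k c q) {h : ℝ} (hh : 0 < h) :
    IntegrableOn (fun α => f α * stripeWeight h α) (Set.Ioi 0) := by
  have := ((isJumpProfile_stripeProfile hh 1).integrableOn_and_integral_of_gap hk
    (by positivity) (ℓ := h) fun i _ => by push_cast; ring).1
  refine (this.const_mul (1 / 2)).congr (Eventually.of_forall fun α => ?_)
  push_cast
  ring

/-- The interaction of stripes of width `h` only sees `|z| ≥ h`, where `k z ≤ c |z| ^ (-3)`. -/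
theorem stripePotential_le (hk : IsLaplaceKernel f k c q) {h : ℝ} (hh : 1 ≤ h) :
    stripePotential f h ≤ 2 * c / h := by
  have hh0 : 0 < h := by linarith
  have hp := isJumpProfile_stripeProfile hh0 1
  have hgap : ∀ i < 2 * 1, ((fun i : ℕ => (i : ℝ) * h) (i + 1)) - (fun i : ℕ => (i : ℝ) * h) i = h :=
    fun i _ => by push_cast; ring
  have h1 := (hp.integrableOn_and_integral_of_gap hk (by positivity) hgap).2
  have hL : 0 ≤ 2 * ((1 : ℕ) : ℝ) * h := by positivity
  have hc0 : 0 ≤ c := by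
    have := (hk.kernel_nonneg one_ne_zero).trans (hk.le 1 one_ne_zero)
    simpa using this
  have h2 : ∫ z, k z * ((2 * 1 : ℕ) * |z| - mismatch (stripeProfile h) (2 * (1 : ℕ) * h) z) ≤
      ∫ z : ℝ, (2 * c) * {z : ℝ | h ≤ |z|}.indicator (fun z => |z| ^ (1 - 3 : ℝ)) z := by
    refine integral_mono_ae
      (hk.integrable_kernel_mul hp.measurable_excess hh0
        (fun z hz => hp.excess_eq_zero (fun i hi => (hgap i hi).ge) hz.le)
        (hp.abs_excess_le hL hh0 fun i hi => (hgap i hi).ge))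
      ((integrable_rpow_indicator le_rfl hh0).const_mul _) ?_
    filter_upwards [volume.ae_ne 0] with z hz
    by_cases hzh : h ≤ |z|
    · have hz1 : 1 ≤ |z| := hh.trans hzh
      rw [Set.indicator_of_mem (by exact hzh)]
      have h3 : |z| ^ (-q) ≤ |z| ^ (-3 : ℝ) :=
        Real.rpow_le_rpow_of_exponent_le hz1 (by linarith [hk.three_le])
      have h4 : k z ≤ c * |z| ^ (-3 : ℝ) := (hk.le z hz).trans (by gcongr)
      have h5 := mismatch_nonneg (g := stripeProfile h) hL z
      calc k z * ((2 * 1 : ℕ) * |z| - mismatch (stripeProfile h) (2 * (1 : ℕ) * h) z)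
          ≤ k z * (2 * |z|) :=
            mul_le_mul_of_nonneg_left
              (by rw [show ((2 * 1 : ℕ) : ℝ) = 2 by norm_num]; linarith) (hk.kernel_nonneg hz)
        _ ≤ (c * |z| ^ (-3 : ℝ)) * (2 * |z|) := by gcongr
        _ = 2 * c * (|z| ^ (-3 : ℝ) * |z| ^ (1 : ℝ)) := by rw [Real.rpow_one]; ring
        _ = 2 * c * |z| ^ (1 - 3 : ℝ) := by
            rw [← Real.rpow_add (by linarith)]; norm_num
    · rw [Set.indicator_of_notMem (by exact hzh),
        hp.excess_eq_zero (fun i hi => (hgap i hi).ge) (not_le.1 hzh).le]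
      simp
  rw [h1, integral_const_mul, integral_sq_inv_indicator hh0] at h2
  push_cast at h2
  calc stripePotential f h ≤ (2 * c * (2 / h)) / 2 := by linarith
    _ = 2 * c / h := by ring

theorem le_stripePotential (hk : IsLaplaceKernel f k c q) {h : ℝ} (hh : 0 < h) :
    h ^ 2 * k (2 * h) ≤ stripePotential f h := by
  have h2 : (2 * h) ≠ 0 := by positivity
  rw [hk.eq _ h2, ← integral_const_mul, stripePotential]
  refine setIntegral_mono_on ((hk.integrableOn _ h2).const_mul _)
    (hk.integrableOn_mul_stripeWeight hh) measurableSet_Ioi fun α hα => ?_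
  rw [mul_left_comm]
  refine mul_le_mul_of_nonneg_left ?_ (hk.nonneg α)
  rw [abs_of_pos (by positivity)]
  exact le_stripeWeight hα hh

theorem stripePotential_nonneg (hk : IsLaplaceKernel f k c q) (h : ℝ) :
    0 ≤ stripePotential f h :=
  integral_nonneg fun α => mul_nonneg (hk.nonneg α) (stripeWeight_nonneg h α)

theorem stripePotential_anti (hk : IsLaplaceKernel f k c q) {x y : ℝ} (hx : 0 < x) (hxy : x ≤ y) :
    stripePotential f y ≤ stripePotential f x :=
  setIntegral_mono_on (hk.integrableOn_mul_stripeWeight (hx.trans_le hxy))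
    (hk.integrableOn_mul_stripeWeight hx) measurableSet_Ioi fun α hα =>
      mul_le_mul_of_nonneg_left (stripeWeight_anti (le_of_lt hα) hxy) (hk.nonneg α)

theorem strictConvexOn_stripePotential (hk : IsLaplaceKernel f k c q) {z : ℝ} (hz : z ≠ 0)
    (hkz : 0 < k z) : StrictConvexOn ℝ (Set.Ioi 0) (stripePotential f) := by
  refine ⟨convex_Ioi 0, fun x hx y hy hxy a b ha hb hab => ?_⟩
  simp only [smul_eq_mul]
  have hx' : 0 < x := hx
  have hy' : 0 < y := hy
  have ix := (hk.integrableOn_mul_stripeWeight hx').const_mul a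
  have iy := (hk.integrableOn_mul_stripeWeight hy').const_mul b
  have iadd : Integrable (fun α => a * (f α * stripeWeight x α) + b * (f α * stripeWeight y α))
      (volume.restrict (Set.Ioi 0)) := ix.add iy
  have ixy := hk.integrableOn_mul_stripeWeight (h := a * x + b * y) (by positivity)
  rw [stripePotential, stripePotential, stripePotential, ← integral_const_mul,
    ← integral_const_mul, ← integral_add ix iy, ← sub_pos, ← integral_sub iadd ixy]
  have hlt : ∀ α ∈ Set.Ioi (0 : ℝ), 0 < a * stripeWeight x α + b * stripeWeight y α -
      stripeWeight (a * x + b * y) α := fun α hα =>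
    sub_pos.2 (stripeWeight_lt hα hx' hy' hxy ha hb hab)
  have e : ∀ α, a * (f α * stripeWeight x α) + b * (f α * stripeWeight y α) -
      f α * stripeWeight (a * x + b * y) α = f α * (a * stripeWeight x α + b * stripeWeight y α -
        stripeWeight (a * x + b * y) α) := fun α => by ring
  have hnn : 0 ≤ᵐ[volume.restrict (Set.Ioi 0)] fun α => a * (f α * stripeWeight x α) +
      b * (f α * stripeWeight y α) - f α * stripeWeight (a * x + b * y) α := by
    filter_upwards [ae_restrict_mem measurableSet_Ioi] with α hα
    rw [Pi.zero_apply, e]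
    exact mul_nonneg (hk.nonneg α) (hlt α hα).le
  refine lt_of_le_of_ne (integral_nonneg_of_ae hnn) fun h0 => ?_
  have h1 := (integral_eq_zero_iff_of_nonneg_ae hnn (iadd.sub ixy)).1 h0.symm
  -- equality would force `f = 0` almost everywhere, hence `k z = 0`
  have h2 : k z = 0 := by
    rw [hk.eq z hz]
    refine integral_eq_zero_of_ae ?_
    filter_upwards [h1, ae_restrict_mem measurableSet_Ioi] with α hα hα'
    rw [Pi.zero_apply, e] at hα
    have : f α = 0 := by
      rcases mul_eq_zero.1 hα with h | h
      · exact h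
      · exact absurd h (hlt α hα').ne'
    simp [this]
  exact hkz.ne' h2

end IsLaplaceKernel

/-! ### Minimizing the energy density over the width -/

section

variable {φ : ℝ → ℝ}

/-- Jensen's inequality for gaps of total length `L`. -/
theorem mul_le_sum_of_convex (hφ : StrictConvexOn ℝ (Set.Ioi 0) φ) {N : ℕ} (hN : 0 < N)
    {ℓ : ℕ → ℝ} {L : ℝ} (hℓ : ∀ i < N, 0 < ℓ i) (hsum : ∑ i ∈ Finset.range N, ℓ i = L) :
    N * φ (L / N) ≤ ∑ i ∈ Finset.range N, φ (ℓ i) := by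
  have hN' : (0 : ℝ) < N := by exact_mod_cast hN
  have := hφ.convexOn.map_sum_le (t := Finset.range N) (w := fun _ => 1 / (N : ℝ)) (p := ℓ)
    (fun _ _ => by positivity) (by simp [hN'.ne']) fun i hi => hℓ i (Finset.mem_range.1 hi)
  simp only [smul_eq_mul, ← Finset.mul_sum, hsum] at this
  rw [one_div_mul_eq_div, one_div_mul_eq_div, le_div_iff₀ hN'] at this
  linarith

theorem eq_of_sum_le_of_convex (hφ : StrictConvexOn ℝ (Set.Ioi 0) φ) {N : ℕ} (hN : 0 < N)
    {ℓ : ℕ → ℝ} {L : ℝ} (hℓ : ∀ i < N, 0 < ℓ i) (hsum : ∑ i ∈ Finset.range N, ℓ i = L)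
    (hle : ∑ i ∈ Finset.range N, φ (ℓ i) ≤ N * φ (L / N)) {i : ℕ} (hi : i < N) :
    ℓ i = L / N := by
  have hN' : (0 : ℝ) < N := by exact_mod_cast hN
  have h := hφ.eq_of_le_map_sum (t := Finset.range N) (w := fun _ => 1 / (N : ℝ)) (p := ℓ)
    (fun _ _ => by positivity) (by simp [hN'.ne'])
    (fun i hi => hℓ i (Finset.mem_range.1 hi)) (by
      simp only [smul_eq_mul, ← Finset.mul_sum, hsum]
      rw [one_div_mul_eq_div, one_div_mul_eq_div, div_le_iff₀ hN']
      linarith)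
  have h2 : ∑ j ∈ Finset.range N, ℓ j = ∑ _j ∈ Finset.range N, ℓ i :=
    Finset.sum_congr rfl fun j hj => h hj (Finset.mem_range.2 hi)
  rw [hsum] at h2
  rw [h2]
  simp only [Finset.sum_const, Finset.card_range, nsmul_eq_mul]
  field_simp

/-- For strictly convex `φ` the function `φ h / h` is strictly quasiconvex. -/
theorem div_lt_max_of_convex (hφ : StrictConvexOn ℝ (Set.Ioi 0) φ) {u v w : ℝ} (hu : 0 < u)
    (huv : u < v) (hvw : v < w) : φ v / v < max (φ u / u) (φ w / w) := by
  have huw : 0 < w - u := by linarith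
  set M := max (φ u / u) (φ w / w)
  have hv : 0 < v := hu.trans huv
  have hw : 0 < w := hv.trans hvw
  have h3 : 0 < (w - v) / (w - u) := div_pos (by linarith) huw
  have h4 : 0 < (v - u) / (w - u) := div_pos (by linarith) huw
  have h := hφ.2 (Set.mem_Ioi.2 hu) (Set.mem_Ioi.2 hw) (by linarith) h3 h4 (by field_simp; ring)
  simp only [smul_eq_mul] at h
  have e : (w - v) / (w - u) * u + (v - u) / (w - u) * w = v := by field_simp; ring
  have h1 : φ u ≤ M * u := (div_le_iff₀ hu).1 (le_max_left _ _)
  have h2 : φ w ≤ M * w := (div_le_iff₀ hw).1 (le_max_right _ _)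
  rw [div_lt_iff₀ hv]
  calc φ v < (w - v) / (w - u) * φ u + (v - u) / (w - u) * φ w := by rwa [e] at h
    _ ≤ (w - v) / (w - u) * (M * u) + (v - u) / (w - u) * (M * w) := by gcongr
    _ = M * ((w - v) / (w - u) * u + (v - u) / (w - u) * w) := by ring
    _ = M * v := by rw [e]

variable {h₀ h₁ : ℝ}

/-- The energy density `φ h / h` attains its minimum, at a width of at most `2 h₀`. -/
theorem exists_optimal_width (hφ : StrictConvexOn ℝ (Set.Ioi 0) φ) (hlow : ∀ h, -1 ≤ φ h)
    (hanti : ∀ x y, 0 < x → x ≤ y → φ y ≤ φ x) (hh₀ : 0 < h₀) (h₀le : φ h₀ ≤ -1 / 2)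
    (hh₁ : 0 < h₁) (h₁pos : 0 < φ h₁) :
    ∃ s, 0 < s ∧ s ≤ 2 * h₀ ∧ ∀ h, 0 < h → φ s / s ≤ φ h / h := by
  have hlt : h₁ < h₀ := by
    by_contra! hcon
    linarith [hanti _ _ hh₀ hcon]
  have hcont : ContinuousOn (fun h => φ h / h) (Set.Icc h₁ (2 * h₀)) := by
    have hsub : Set.Icc h₁ (2 * h₀) ⊆ Set.Ioi 0 := fun y hy => hh₁.trans_le hy.1
    exact ((hφ.convexOn.continuousOn isOpen_Ioi).mono hsub).div continuousOn_id
      fun y hy => (hsub hy).ne'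
  obtain ⟨s, hs, hmin⟩ := isCompact_Icc.exists_isMinOn ⟨h₀, hlt.le, by linarith⟩ hcont
  have hs0 : φ s / s ≤ φ h₀ / h₀ := hmin (show h₀ ∈ Set.Icc h₁ (2 * h₀) from ⟨hlt.le, by linarith⟩)
  have hneg : φ h₀ / h₀ ≤ -1 / (2 * h₀) := by
    rw [div_le_div_iff₀ hh₀ (by positivity)]; nlinarith
  refine ⟨s, hh₁.trans_le hs.1, hs.2, fun h hh => ?_⟩
  rcases lt_or_ge h h₁ with h1 | h1
  · have : 0 < φ h / h := div_pos (h₁pos.trans_le (hanti _ _ hh h1.le)) hh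
    have : -1 / (2 * h₀) < 0 := div_neg_of_neg_of_pos (by norm_num) (by positivity)
    linarith
  · rcases le_or_gt h (2 * h₀) with h2 | h2
    · exact hmin (show h ∈ Set.Icc h₁ (2 * h₀) from ⟨h1, h2⟩)
    · refine (hs0.trans hneg).trans ?_
      rw [div_le_div_iff₀ (by positivity) hh]
      nlinarith [hlow h]

/-- If the minimum over the widths `L / (2n)` is attained at `n`, then the optimal width `s` lies
between the neighbours `L / (2(n+1))` and `L / (2(n-1))` by quasiconvexity, that is,
`|2n / L - 1 / s| ≤ 2 / L`. -/
theorem abs_sub_le_of_grid_min (hφ : StrictConvexOn ℝ (Set.Ioi 0) φ) {s L : ℝ} (hs : 0 < s)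
    (hs₀ : s ≤ 2 * h₀) (hopt : ∀ h, 0 < h → φ s / s ≤ φ h / h) (hL : 0 < L) {n : ℕ} (hn : 0 < n)
    (hmin : ∀ n' : ℕ, 0 < n' →
      φ (L / (2 * n)) / (L / (2 * n)) ≤ φ (L / (2 * n')) / (L / (2 * n'))) :
    |L / (2 * n) - s| ≤ 32 * h₀ ^ 2 / L := by
  have hn' : (1 : ℝ) ≤ n := by exact_mod_cast hn
  set h := L / (2 * n) with hh
  have hpos : 0 < h := by positivity
  have hinv : 1 / h = 2 * n / L := by rw [hh, one_div_div]
  have hub : 1 / h ≤ 1 / s + 2 / L := by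
    by_contra! hcon
    have hn2 : (1 : ℝ) < n := by
      have : 0 < 1 / s := by positivity
      rw [hinv] at hcon
      have : 2 / L < 2 * n / L := by linarith
      rw [div_lt_div_iff_of_pos_right hL] at this
      linarith
    have hn3 : 1 < n := by exact_mod_cast hn2
    have hcast : ((n - 1 : ℕ) : ℝ) = n - 1 := by push_cast [hn3.le]; ring
    have hm := hmin (n - 1) (by omega)
    rw [hcast] at hm
    have h1 : h < L / (2 * (n - 1)) := by
      rw [hh]; gcongr
      linarith
    have h2 : L / (2 * (n - 1)) < s := by
      rw [hinv] at hcon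
      rw [div_lt_iff₀ (by linarith)]
      have h3 : 1 / s < 2 * (n - 1) / L := by
        have : 2 * ((n : ℝ) - 1) / L = 2 * n / L - 2 / L := by ring
        linarith
      rw [div_lt_div_iff₀ hs hL] at h3
      linarith
    have := div_lt_max_of_convex hφ hpos h1 h2
    rw [max_eq_left (hopt h hpos)] at this
    linarith
  have hlb : 1 / s ≤ 1 / h + 2 / L := by
    by_contra! hcon
    have hm := hmin (n + 1) (by omega)
    push_cast at hm
    have h1 : L / (2 * (n + 1)) < h := by
      rw [hh]; gcongr
      linarith
    have h2 : s < L / (2 * (n + 1)) := by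
      rw [hinv] at hcon
      rw [lt_div_iff₀ (by linarith)]
      have h3 : 2 * (n + 1) / L < 1 / s := by
        have : 2 * ((n : ℝ) + 1) / L = 2 * n / L + 2 / L := by ring
        linarith
      rw [div_lt_div_iff₀ hL hs] at h3
      linarith
    have := div_lt_max_of_convex hφ hs h2 h1
    rw [max_eq_right (hopt h hpos)] at this
    linarith
  have hdiff : |h - s| ≤ h * s * (2 / L) := by
    have e1 : h - s = h * s * (1 / s - 1 / h) := by field_simp
    rw [e1, abs_mul, abs_of_pos (by positivity)]
    gcongr
    rw [abs_le]; constructor <;> linarith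
  have hh₀ : 0 < h₀ := by linarith
  have hhle : h ≤ 4 * h₀ := by
    rcases le_total L (8 * h₀) with h8 | h8
    · have : h ≤ L / 2 := by rw [hh]; gcongr; linarith
      linarith
    · have h1 : 1 / (2 * h₀) ≤ 1 / s := by gcongr
      have h2 : 2 / L ≤ 2 / (8 * h₀) := by gcongr
      have h3 : 1 / (4 * h₀) ≤ 1 / h := by
        have : 1 / (4 * h₀) = 1 / (2 * h₀) - 2 / (8 * h₀) := by field_simp; norm_num
        linarith
      exact (one_div_le_one_div (by positivity) hpos).1 h3
  calc |h - s| ≤ h * s * (2 / L) := hdiff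
    _ ≤ (4 * h₀) * (2 * h₀) * (2 / L) := by gcongr
    _ = 16 * h₀ ^ 2 / L := by ring
    _ ≤ 32 * h₀ ^ 2 / L := by gcongr; norm_num

/-- Widths below `h₁` have positive energy, so only finitely many `n` compete. -/
theorem exists_grid_min (hanti : ∀ x y, 0 < x → x ≤ y → φ y ≤ φ x) (hh₁ : 0 < h₁)
    (h₁pos : 0 < φ h₁) {L : ℝ} (hL : 0 < L) {n₀ : ℕ} (hn₀ : 0 < n₀)
    (hneg : φ (L / (2 * n₀)) / (L / (2 * n₀)) < 0) :
    ∃ n : ℕ, 0 < n ∧ φ (L / (2 * n)) / (L / (2 * n)) < 0 ∧ ∀ n' : ℕ, 0 < n' →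
      φ (L / (2 * n)) / (L / (2 * n)) ≤ φ (L / (2 * n')) / (L / (2 * n')) := by
  have hlarge : ∀ n : ℕ, 0 < n → φ (L / (2 * n)) / (L / (2 * n)) < 0 → n ≤ ⌈L / h₁⌉₊ := by
    intro n hn hlt
    have hn' : (0 : ℝ) < n := by exact_mod_cast hn
    have hpos : 0 < L / (2 * n) := by positivity
    have h1 : h₁ < L / (2 * n) := by
      by_contra! hcon
      have := hanti _ _ hpos hcon
      exact absurd hlt (not_lt.2 (div_nonneg (by linarith) hpos.le))
    rw [lt_div_iff₀ (by positivity)] at h1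
    have h2 : (n : ℝ) ≤ L / h₁ := by
      rw [le_div_iff₀ hh₁]; nlinarith [mul_pos hh₁ hn']
    exact_mod_cast h2.trans (Nat.le_ceil _)
  obtain ⟨n, hn, hmin⟩ := Finset.exists_min_image (Finset.Icc 1 ⌈L / h₁⌉₊)
    (fun n : ℕ => φ (L / (2 * n)) / (L / (2 * n)))
    ⟨n₀, Finset.mem_Icc.2 ⟨hn₀, hlarge n₀ hn₀ hneg⟩⟩
  have hn0 := hmin n₀ (Finset.mem_Icc.2 ⟨hn₀, hlarge n₀ hn₀ hneg⟩)
  refine ⟨n, (Finset.mem_Icc.1 hn).1, by linarith, fun n' hn' => ?_⟩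
  by_cases hneg' : φ (L / (2 * n')) / (L / (2 * n')) < 0
  · exact hmin n' (Finset.mem_Icc.2 ⟨hn', hlarge n' hn' hneg'⟩)
  · linarith

end

/-! ### The distribution function of a Jordan pair -/

theorem exists_tsupport_subset_Ioo {φ : ℝ → ℝ} (hc : HasCompactSupport φ) :
    ∃ R > 0, tsupport φ ⊆ Set.Ioo (-R) R := by
  obtain ⟨R, hR, h⟩ := hc.isCompact.isBounded.subset_ball_lt 0 0
  refine ⟨R, hR, h.trans ?_⟩
  rw [Real.ball_eq_Ioo, zero_sub, zero_add]

/-- The du Bois-Reymond lemma: a function with vanishing distributional derivative is constant. -/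
theorem ae_eq_const_of_integral_deriv_eq_zero {u : ℝ → ℝ} (hu : LocallyIntegrable u)
    (h : ∀ φ : ℝ → ℝ, ContDiff ℝ (⊤ : ℕ∞) φ → HasCompactSupport φ → ∫ x, deriv φ x * u x = 0) :
    ∃ c : ℝ, u =ᵐ[volume] fun _ => c := by
  let b : ContDiffBump (0 : ℝ) := ⟨1, 2, one_pos, one_lt_two⟩
  set ρ : ℝ → ℝ := b.normed volume
  have hρ : ContDiff ℝ (⊤ : ℕ∞) ρ := b.contDiff_normed
  have hρc : HasCompactSupport ρ := b.hasCompactSupport_normed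
  have hρ1 : ∫ x, ρ x = 1 := b.integral_normed
  have hint : ∀ ψ : ℝ → ℝ, ContDiff ℝ (⊤ : ℕ∞) ψ → HasCompactSupport ψ →
      Integrable fun x => ψ x * u x := fun ψ h1 h2 => by
    simpa only [smul_eq_mul] using hu.integrable_smul_left_of_hasCompactSupport h1.continuous h2
  refine ⟨∫ x, ρ x * u x, ?_⟩
  set c := ∫ x, ρ x * u x with hc
  have key : ∀ᵐ x, u x - c = 0 := by
    refine ae_eq_zero_of_integral_contDiff_smul_eq_zero
      (f := fun x => u x - c) (hu.sub (locallyIntegrable_const c)) fun ψ hψ hψc => ?_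
    set m := ∫ x, ψ x with hm
    -- `η` has mean zero, so that its primitive `Φ` has compact support
    set η : ℝ → ℝ := fun x => ψ x - m * ρ x with hη
    have hηd : ContDiff ℝ (⊤ : ℕ∞) η := hψ.sub (contDiff_const.mul hρ)
    have hηc : HasCompactSupport η := hψc.sub (hρc.mul_left)
    have hη0 : ∫ x, η x = 0 := by
      rw [hη, integral_sub (hψ.continuous.integrable_of_hasCompactSupport hψc)
        ((hρ.continuous.integrable_of_hasCompactSupport hρc).const_mul m), integral_const_mul,
        hρ1, mul_one, sub_self]
    obtain ⟨R, hR, hsupp⟩ := exists_tsupport_subset_Ioo hηc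
    have hηz : ∀ x, x ∉ Set.Ioo (-R) R → η x = 0 := fun x hx =>
      image_eq_zero_of_notMem_tsupport fun hx' => hx (hsupp hx')
    set Φ : ℝ → ℝ := fun x => ∫ t in (-R)..x, η t with hΦ
    have hderiv : ∀ x, HasDerivAt Φ (η x) x := fun x =>
      intervalIntegral.integral_hasDerivAt_right
        (hηd.continuous.intervalIntegrable _ _)
        hηd.continuous.stronglyMeasurable.stronglyMeasurableAtFilter
        hηd.continuous.continuousAt
    have hΦ' : deriv Φ = η := funext fun x => (hderiv x).deriv
    have hΦd : ContDiff ℝ (⊤ : ℕ∞) Φ := by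
      rw [contDiff_infty_iff_deriv]
      exact ⟨fun x => (hderiv x).differentiableAt, by rw [hΦ']; exact hηd⟩
    have hfull : ∫ t in (-R)..R, η t = 0 := by
      rw [intervalIntegral.integral_of_le (by linarith), ← hη0]
      refine setIntegral_eq_integral_of_forall_compl_eq_zero fun x hx => hηz x fun hx' => hx ?_
      exact ⟨hx'.1, hx'.2.le⟩
    have hΦc : HasCompactSupport Φ := by
      refine HasCompactSupport.of_support_subset_isCompact (K := Set.Icc (-R) R) isCompact_Icc ?_
      intro x hx
      by_contra hcon
      refine hx ?_
      rcases lt_or_ge x (-R) with h1 | h1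
      · have : ∫ t in (-R)..x, η t = ∫ t in (-R)..x, (0 : ℝ) :=
          intervalIntegral.integral_congr fun t ht => by
            rw [Set.uIcc_of_ge h1.le] at ht
            exact hηz t fun ht' => by linarith [ht.2, ht'.1]
        simp only [hΦ, this, intervalIntegral.integral_zero]
      · have h2 : R < x := by
          by_contra! h3; exact hcon ⟨h1, h3⟩
        have : ∫ t in R..x, η t = ∫ t in R..x, (0 : ℝ) :=
          intervalIntegral.integral_congr fun t ht => by
            rw [Set.uIcc_of_le h2.le] at ht
            exact hηz t fun ht' => by linarith [ht.1, ht'.2]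
        simp only [hΦ]
        rw [← intervalIntegral.integral_add_adjacent_intervals
          (hηd.continuous.intervalIntegrable (-R) R) (hηd.continuous.intervalIntegrable R x),
          hfull, this]
        simp
    have h0 := h Φ hΦd hΦc
    rw [hΦ'] at h0
    have e : ∫ x, η x * u x = (∫ x, ψ x * u x) - m * c := by
      rw [hc, ← integral_const_mul, ← integral_sub (hint ψ hψ hψc) ((hint ρ hρ hρc).const_mul m)]
      refine integral_congr_ae (Eventually.of_forall fun x => ?_)
      simp only [hη]; ring
    have e2 : ∫ x, ψ x • (u x - c) = (∫ x, ψ x * u x) - m * c := by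
      rw [hm, ← integral_mul_const, ← integral_sub (hint ψ hψ hψc)
        ((hψ.continuous.integrable_of_hasCompactSupport hψc).mul_const c)]
      refine integral_congr_ae (Eventually.of_forall fun x => ?_)
      simp only [smul_eq_mul]; ring
    rw [e2, ← e, h0]
  filter_upwards [key] with x hx
  linarith

/-- The right-continuous distribution function of a locally finite measure, normalized to vanish
at `0`. -/
def cumulative (μ : Measure ℝ) (x : ℝ) : ℝ :=
  if 0 ≤ x then μ.real (Set.Ioc 0 x) else -μ.real (Set.Ioc x 0)

section

variable {μ : Measure ℝ} [IsLocallyFiniteMeasure μ]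

theorem measureReal_Ioc_add {a b c : ℝ} (hab : a ≤ b) (hbc : b ≤ c) :
    μ.real (Set.Ioc a b) + μ.real (Set.Ioc b c) = μ.real (Set.Ioc a c) := by
  rw [← Set.Ioc_union_Ioc_eq_Ioc hab hbc, measureReal_union (Set.Ioc_disjoint_Ioc_of_le le_rfl)
    measurableSet_Ioc measure_Ioc_lt_top.ne measure_Ioc_lt_top.ne]

theorem cumulative_sub {a b : ℝ} (hab : a ≤ b) :
    cumulative μ b - cumulative μ a = μ.real (Set.Ioc a b) := by
  unfold cumulative
  split_ifs with hb ha ha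
  · linarith [measureReal_Ioc_add (μ := μ) ha hab]
  · linarith [measureReal_Ioc_add (μ := μ) (not_le.1 ha).le hb]
  · linarith
  · linarith [measureReal_Ioc_add (μ := μ) hab (not_le.1 hb).le]

theorem monotone_cumulative : Monotone (cumulative μ) := fun a b hab => by
  have := cumulative_sub (μ := μ) hab
  have h2 : 0 ≤ μ.real (Set.Ioc a b) := measureReal_nonneg
  linarith

/-- The distributional derivative of the distribution function of `μ` is `μ`. -/
theorem integral_eq_neg_integral_deriv_mul_cumulative {φ : ℝ → ℝ}
    (hφ : ContDiff ℝ (⊤ : ℕ∞) φ) (hc : HasCompactSupport φ) :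
    ∫ x, φ x ∂μ = -∫ x, deriv φ x * cumulative μ x := by
  obtain ⟨R, hR, hsupp⟩ := exists_tsupport_subset_Ioo hc
  have hφz : ∀ x, x ∉ Set.Ioo (-R) R → φ x = 0 := fun x hx =>
    image_eq_zero_of_notMem_tsupport fun hx' => hx (hsupp hx')
  have hφz' : ∀ x, x ∉ Set.Ioo (-R) R → deriv φ x = 0 := fun x hx => by
    by_contra h
    exact hx (hsupp (support_deriv_subset h))
  have hdc : Continuous (deriv φ) := hφ.continuous_deriv (by simp)
  have hdint : Integrable (deriv φ) := hdc.integrable_of_hasCompactSupport hc.deriv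
  have hFTC : ∀ a b : ℝ, ∫ x in a..b, deriv φ x = φ b - φ a := fun a b =>
    intervalIntegral.integral_deriv_eq_sub
      (fun x _ => (hφ.differentiable (by simp)).differentiableAt) (hdc.intervalIntegrable _ _)
  set I := Set.Ioc (-R) R with hI
  have hfin : IsFiniteMeasure (μ.restrict I) := ⟨by
    rw [Measure.restrict_apply_univ]; exact measure_Ioc_lt_top⟩
  have hnot : ∀ x, x ∉ I → x ∉ Set.Ioo (-R) R := fun x hx hx' => hx ⟨hx'.1, hx'.2.le⟩
  set S : Set (ℝ × ℝ) := {v | v.1 ≤ v.2} with hS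
  have hSm : MeasurableSet S := measurableSet_le measurable_fst measurable_snd
  -- Fubini for `φ y = -∫ x in y..R, deriv φ x`, written with the indicator of `y ≤ x`
  have hprod : Integrable (Function.uncurry fun y x => S.indicator (fun v => deriv φ v.2) (y, x))
      ((μ.restrict I).prod (volume.restrict I)) := by
    have h1 : Integrable (fun v : ℝ × ℝ => (1 : ℝ) * deriv φ v.2)
        ((μ.restrict I).prod (volume.restrict I)) :=
      Integrable.mul_prod (f := fun _ => (1 : ℝ)) (integrable_const _) hdint.restrict
    simp only [one_mul] at h1
    exact h1.indicator hSm
  have inner1 : ∀ y ∈ I, ∫ x in I, S.indicator (fun v => deriv φ v.2) (y, x) = -φ y := by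
    intro y hy
    have e : ∀ x, S.indicator (fun v => deriv φ v.2) (y, x) =
        (Set.Ici y).indicator (deriv φ) x := fun x => rfl
    simp only [e]
    rw [setIntegral_indicator measurableSet_Ici]
    have e2 : I ∩ Set.Ici y = Set.Icc y R := by
      ext x; simp only [hI, Set.mem_inter_iff, Set.mem_Ioc, Set.mem_Ici, Set.mem_Icc]
      exact ⟨fun h => ⟨h.2, h.1.2⟩, fun h => ⟨⟨hy.1.trans_le h.1, h.2⟩, h.1⟩⟩
    rw [e2, integral_Icc_eq_integral_Ioc, ← intervalIntegral.integral_of_le hy.2, hFTC,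
      hφz R (fun h => lt_irrefl _ h.2), zero_sub]
  have inner2 : ∀ x ∈ I, ∫ y in I, S.indicator (fun v => deriv φ v.2) (y, x) ∂μ =
      deriv φ x * cumulative μ x - cumulative μ (-R) * deriv φ x := by
    intro x hx
    have e : ∀ y, S.indicator (fun v => deriv φ v.2) (y, x) =
        (Set.Iic x).indicator (fun _ => deriv φ x) y := fun y => rfl
    simp only [e]
    rw [setIntegral_indicator measurableSet_Iic]
    have e2 : I ∩ Set.Iic x = Set.Ioc (-R) x := by
      ext y; simp only [hI, Set.mem_inter_iff, Set.mem_Ioc, Set.mem_Iic]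
      exact ⟨fun h => ⟨h.1.1, h.2⟩, fun h => ⟨⟨h.1, h.2.trans hx.2⟩, h.2⟩⟩
    rw [e2, setIntegral_const, smul_eq_mul, ← cumulative_sub hx.1.le]
    ring
  have hcum : IntegrableOn (fun x => deriv φ x * cumulative μ x) I := by
    have := (monotone_cumulative (μ := μ)).locallyIntegrable (μ := (volume : Measure ℝ))
    have h2 := this.integrable_smul_left_of_hasCompactSupport hdc hc.deriv
    exact h2.integrableOn
  have hfull : ∫ x in I, deriv φ x = 0 := by
    rw [hI, ← intervalIntegral.integral_of_le (by linarith), hFTC,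
      hφz R (fun h => lt_irrefl _ h.2), hφz (-R) (fun h => lt_irrefl _ h.1), sub_zero]
  have hswap := integral_integral_swap hprod
  rw [setIntegral_congr_fun measurableSet_Ioc inner1, setIntegral_congr_fun measurableSet_Ioc inner2,
    integral_neg, integral_sub hcum (hdint.integrableOn.const_mul _), integral_const_mul, hfull,
    mul_zero, sub_zero,
    setIntegral_eq_integral_of_forall_compl_eq_zero fun x hx => hφz x (hnot x hx),
    setIntegral_eq_integral_of_forall_compl_eq_zero fun x hx => by
      rw [hφz' x (hnot x hx), zero_mul]] at hswap
  rw [← hswap, neg_neg]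

end

theorem IsJordanDeriv.exists_ae_eq {E : Set ℝ} {μ ν : Measure ℝ} (hE : NullMeasurableSet E)
    (h : IsJordanDeriv E μ ν) :
    ∃ c : ℝ, chi E =ᵐ[volume] fun x => c + cumulative μ x - cumulative ν x := by
  have := h.locallyFinite_pos
  have := h.locallyFinite_neg
  have hμ := (monotone_cumulative (μ := μ)).locallyIntegrable (μ := (volume : Measure ℝ))
  have hν := (monotone_cumulative (μ := ν)).locallyIntegrable (μ := (volume : Measure ℝ))
  have hχ : LocallyIntegrable (chi E) := by
    have h1 : LocallyIntegrable (fun _ : ℝ => (1 : ℝ)) volume := locallyIntegrable_const 1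
    refine h1.mono (aestronglyMeasurable_const.indicator₀ hE) (Eventually.of_forall fun x => ?_)
    exact norm_indicator_le_norm_self (fun _ => (1 : ℝ)) x
  obtain ⟨c, hc⟩ := ae_eq_const_of_integral_deriv_eq_zero
    (u := fun x => chi E x - (cumulative μ x - cumulative ν x)) (hχ.sub (hμ.sub hν))
    fun φ hφ hφc => by
      have hdc : Continuous (deriv φ) := hφ.continuous_deriv (by simp)
      have i1 : Integrable fun x => deriv φ x * chi E x := by
        simpa only [smul_eq_mul] using
          hχ.integrable_smul_left_of_hasCompactSupport hdc hφc.deriv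
      have i2 : Integrable fun x => deriv φ x * cumulative μ x := by
        simpa only [smul_eq_mul] using
          hμ.integrable_smul_left_of_hasCompactSupport hdc hφc.deriv
      have i3 : Integrable fun x => deriv φ x * cumulative ν x := by
        simpa only [smul_eq_mul] using
          hν.integrable_smul_left_of_hasCompactSupport hdc hφc.deriv
      have e1 : ∫ x in E, deriv φ x = ∫ x, deriv φ x * chi E x := by
        rw [← integral_indicator₀ hE]
        refine integral_congr_ae (Eventually.of_forall fun x => ?_)
        by_cases hx : x ∈ E <;> simp [chi, hx]
      have h1 := h.integral_deriv φ hφ hφc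
      rw [integral_eq_neg_integral_deriv_mul_cumulative hφ hφc,
        integral_eq_neg_integral_deriv_mul_cumulative hφ hφc, e1] at h1
      have e2 : ∫ x, deriv φ x * (chi E x - (cumulative μ x - cumulative ν x)) =
          (∫ x, deriv φ x * chi E x) - ((∫ x, deriv φ x * cumulative μ x) -
            ∫ x, deriv φ x * cumulative ν x) := by
        rw [← integral_sub i2 i3, ← integral_sub i1 (by exact i2.sub i3)]
        refine integral_congr_ae (Eventually.of_forall fun x => ?_)
        ring
      rw [e2, h1]; ring
  refine ⟨c, ?_⟩
  filter_upwards [hc] with x hx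
  linarith

/-! ### Step versions and the reduced boundary -/

/-- `g` is a right-continuous representative of the characteristic function of `E` with left
limits. As `g` takes only the values `0` and `1`, these conditions say that it is locally constant on
either side of each point. -/
structure IsStepVersion (g : ℝ → ℝ) (E : Set ℝ) : Prop where
  measurable : Measurable g
  zero_or_one : ∀ y, g y = 0 ∨ g y = 1
  ae_eq : chi E =ᵐ[volume] g
  right : ∀ x, ∃ δ > 0, ∀ y ∈ Set.Ico x (x + δ), g y = g x
  left : ∀ x, ∃ δ > 0, ∃ c, ∀ y ∈ Set.Ioo (x - δ) x, g y = c

theorem chi_zero_or_one (E : Set ℝ) (x : ℝ) : chi E x = 0 ∨ chi E x = 1 := by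
  by_cases h : x ∈ E <;> simp [chi, h]

theorem exists_mem_Ioo_of_ae {P : ℝ → Prop} (h : ∀ᵐ x, P x) {a b : ℝ} (hab : a < b) :
    ∃ x ∈ Set.Ioo a b, P x := by
  by_contra! hcon
  have h0 : volume (Set.Ioo a b) = 0 :=
    measure_mono_null (fun x hx => hcon x hx) (ae_iff.1 h)
  rw [Real.volume_Ioo, ENNReal.ofReal_eq_zero] at h0
  linarith

theorem IsStepVersion.unique {g g' : ℝ → ℝ} {E : Set ℝ} (h : IsStepVersion g E)
    (h' : IsStepVersion g' E) : g = g' := by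
  funext x
  obtain ⟨δ, hδ, hg⟩ := h.right x
  obtain ⟨δ', hδ', hg'⟩ := h'.right x
  obtain ⟨y, hy, hyy⟩ := exists_mem_Ioo_of_ae (h.ae_eq.symm.trans h'.ae_eq)
    (show x < x + min δ δ' by have := lt_min hδ hδ'; linarith)
  rw [← hg y ⟨hy.1.le, hy.2.trans_le (by gcongr; exact min_le_left _ _)⟩, hyy,
    hg' y ⟨hy.1.le, hy.2.trans_le (by gcongr; exact min_le_right _ _)⟩]

/-- Small punctured neighbourhoods of a point have small measure. -/
theorem exists_measure_punctured_lt (μ : Measure ℝ) [IsLocallyFiniteMeasure μ] (x : ℝ)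
    {ε : ℝ} (hε : 0 < ε) : ∃ δ > 0, ∀ s ⊆ Set.Ioo (x - δ) (x + δ) \ {x}, μ.real s < ε := by
  obtain ⟨U, hxU, hU, hlt⟩ := Set.exists_isOpen_lt_add (μ := μ) {x}
    (isCompact_singleton.measure_lt_top.ne) (ENNReal.ofReal_pos.2 hε).ne'
  obtain ⟨δ, hδ, hball⟩ := Metric.isOpen_iff.1 hU x (hxU rfl)
  rw [Real.ball_eq_Ioo] at hball
  refine ⟨δ, hδ, fun s hs => ?_⟩
  have h1 : μ (U \ {x}) < ENNReal.ofReal ε := by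
    have := measure_sdiff_add_inter (μ := μ) U (measurableSet_singleton x)
    rw [Set.inter_eq_self_of_subset_right hxU, add_comm] at this
    rw [← this] at hlt
    exact lt_of_add_lt_add_left hlt
  have h2 : μ s < ENNReal.ofReal ε :=
    (measure_mono (hs.trans (Set.sdiff_subset_sdiff_left hball))).trans_lt h1
  exact (ENNReal.lt_ofReal_iff_toReal_lt h2.ne_top).1 h2

/-- The step version of a set is, up to a constant, the difference of the distribution functions
of a Jordan pair: being right-continuous and almost everywhere `0` or `1`, it has these values
everywhere, and it is locally constant on either side of a point since its oscillation there is
less than one. -/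
theorem IsJordanDeriv.exists_isStepVersion {E : Set ℝ} {μ ν : Measure ℝ}
    (hE : NullMeasurableSet E) (h : IsJordanDeriv E μ ν) :
    ∃ g, IsStepVersion g E ∧ ∀ a b, a ≤ b →
      g b - g a = μ.real (Set.Ioc a b) - ν.real (Set.Ioc a b) := by
  have := h.locallyFinite_pos
  have := h.locallyFinite_neg
  obtain ⟨c, hc⟩ := h.exists_ae_eq hE
  set g : ℝ → ℝ := fun x => c + cumulative μ x - cumulative ν x with hg
  have hinc : ∀ a b, a ≤ b → g b - g a = μ.real (Set.Ioc a b) - ν.real (Set.Ioc a b) :=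
    fun a b hab => by
      rw [← cumulative_sub hab, ← cumulative_sub hab]; simp only [hg]; ring
  have hosc : ∀ x ε : ℝ, 0 < ε → ∃ δ > 0, ∀ a b, a ≤ b →
      Set.Ioc a b ⊆ Set.Ioo (x - δ) (x + δ) \ {x} → |g b - g a| < ε := by
    intro x ε hε
    obtain ⟨δ, hδ, h1⟩ := exists_measure_punctured_lt μ x hε
    obtain ⟨δ', hδ', h2⟩ := exists_measure_punctured_lt ν x hε
    refine ⟨min δ δ', lt_min hδ hδ', fun a b hab hsub => ?_⟩
    have k1 := h1 (Set.Ioc a b) (hsub.trans (Set.sdiff_subset_sdiff_left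
      (Set.Ioo_subset_Ioo (by gcongr; exact min_le_left _ _) (by gcongr; exact min_le_left _ _))))
    have k2 := h2 (Set.Ioc a b) (hsub.trans (Set.sdiff_subset_sdiff_left
      (Set.Ioo_subset_Ioo (by gcongr; exact min_le_right _ _) (by gcongr; exact min_le_right _ _))))
    have k3 : 0 ≤ μ.real (Set.Ioc a b) := measureReal_nonneg
    have k4 : 0 ≤ ν.real (Set.Ioc a b) := measureReal_nonneg
    rw [hinc a b hab, abs_lt]
    constructor <;> linarith
  have hsubr : ∀ x δ a b : ℝ, x ≤ a → b < x + δ → 0 < δ →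
      Set.Ioc a b ⊆ Set.Ioo (x - δ) (x + δ) \ {x} := fun x δ a b h1 h2 h3 y hy =>
    ⟨⟨by linarith [hy.1], by linarith [hy.2]⟩, fun h => by
      rw [Set.mem_singleton_iff] at h; linarith [hy.1]⟩
  have hsubl : ∀ x δ a b : ℝ, x - δ < a → b < x → 0 < δ →
      Set.Ioc a b ⊆ Set.Ioo (x - δ) (x + δ) \ {x} := fun x δ a b h1 h2 h3 y hy =>
    ⟨⟨by linarith [hy.1], by linarith [hy.2]⟩, fun h => by
      rw [Set.mem_singleton_iff] at h; linarith [hy.2]⟩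
  have h01 : ∀ y, g y = 0 ∨ g y = 1 := by
    intro x
    have hcl : g x ∈ closure ({0, 1} : Set ℝ) := by
      rw [Metric.mem_closure_iff]
      intro ε hε
      obtain ⟨δ, hδ, hδ'⟩ := hosc x ε hε
      obtain ⟨y, hy, hyy⟩ := exists_mem_Ioo_of_ae hc (show x < x + δ by linarith)
      refine ⟨g y, ?_, ?_⟩
      · rw [← hyy]; exact chi_zero_or_one E y
      · rw [dist_comm, Real.dist_eq]
        exact hδ' x y hy.1.le (hsubr x δ x y le_rfl hy.2 hδ)
    rw [IsClosed.closure_eq ((Set.finite_singleton (1 : ℝ)).insert 0).isClosed] at hcl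
    exact hcl
  have heq : ∀ a b, |g b - g a| < 1 → g b = g a := by
    intro a b hlt
    rcases h01 a with h | h <;> rcases h01 b with h' | h' <;> simp [h, h'] at hlt ⊢
  refine ⟨g, ⟨?_, h01, hc, fun x => ?_, fun x => ?_⟩, hinc⟩
  · exact (measurable_const.add monotone_cumulative.measurable).sub monotone_cumulative.measurable
  · obtain ⟨δ, hδ, hδ'⟩ := hosc x 1 one_pos
    exact ⟨δ, hδ, fun y hy => heq x y (hδ' x y hy.1 (hsubr x δ x y le_rfl hy.2 hδ))⟩
  · obtain ⟨δ, hδ, hδ'⟩ := hosc x 1 one_pos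
    refine ⟨δ, hδ, g (x - δ / 2), fun y hy => ?_⟩
    rcases le_total y (x - δ / 2) with hle | hle
    · exact (heq _ _ (hδ' y _ hle (hsubl x δ _ _ hy.1 (by linarith) hδ))).symm
    · exact heq _ _ (hδ' _ y hle (hsubl x δ _ _ (by linarith) hy.2 hδ))

theorem LocallyFinitePerimeter.exists_isStepVersion {E : Set ℝ} (h : LocallyFinitePerimeter E) :
    ∃ g, IsStepVersion g E := by
  obtain ⟨hE, μ, ν, hμν⟩ := h
  obtain ⟨g, hg, -⟩ := hμν.exists_isStepVersion hE
  exact ⟨g, hg⟩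

/-- Mutually singular measures which agree on an interval vanish there. -/
theorem measure_eq_zero_of_eq {μ ν : Measure ℝ} [IsLocallyFiniteMeasure μ]
    [IsLocallyFiniteMeasure ν] (hs : μ ⟂ₘ ν) {u v : ℝ}
    (h : ∀ a b, u < a → a ≤ b → b < v → μ.real (Set.Ioc a b) = ν.real (Set.Ioc a b)) :
    μ (Set.Ioo u v) = 0 := by
  have hIoc : ∀ a b, u < a → b < v → μ (Set.Ioc a b) = 0 := by
    intro a b ha hb
    have e : μ.restrict (Set.Ioc a b) = ν.restrict (Set.Ioc a b) := by
      refine Measure.ext_of_Ioc _ _ fun c d _ => ?_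
      rw [Measure.restrict_apply measurableSet_Ioc, Measure.restrict_apply measurableSet_Ioc,
        Set.Ioc_inter_Ioc]
      rcases le_total (max c a) (min d b) with hle | hle
      · have := h (max c a) (min d b) (ha.trans_le (le_max_right _ _)) hle
          ((min_le_right _ _).trans_lt hb)
        exact (measureReal_eq_measureReal_iff measure_Ioc_lt_top.ne measure_Ioc_lt_top.ne).1 this
      · rw [Set.Ioc_eq_empty (not_lt.2 hle)]; simp
    have hs' : μ.restrict (Set.Ioc a b) ⟂ₘ μ.restrict (Set.Ioc a b) := by
      nth_rewrite 2 [e]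
      exact (hs.restrict _).symm.restrict _ |>.symm
    rw [Measure.MutuallySingular.self_iff, Measure.restrict_eq_zero] at hs'
    exact hs'
  refine measure_null_of_locally_null _ fun x hx => ?_
  refine ⟨Set.Ioc ((u + x) / 2) ((x + v) / 2), mem_nhdsWithin_of_mem_nhds
    (Ioc_mem_nhds (by linarith [hx.1]) (by linarith [hx.2])), hIoc _ _ ?_ ?_⟩
  · linarith [hx.1]
  · linarith [hx.2]

theorem continuousAt_iff_of_left_right {g : ℝ → ℝ} {x c δ₁ δ₂ : ℝ} (hδ₁ : 0 < δ₁)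
    (hr : ∀ y ∈ Set.Ico x (x + δ₁), g y = g x) (hδ₂ : 0 < δ₂)
    (hl : ∀ y ∈ Set.Ioo (x - δ₂) x, g y = c) : ContinuousAt g x ↔ g x = c := by
  constructor
  · intro hc
    have t1 : Tendsto g (𝓝[<] x) (𝓝 (g x)) := hc.tendsto.mono_left nhdsWithin_le_nhds
    have t2 : Tendsto g (𝓝[<] x) (𝓝 c) := by
      refine tendsto_const_nhds.congr' ?_
      filter_upwards [Ioo_mem_nhdsLT (show x - δ₂ < x by linarith)] with y hy
      exact (hl y hy).symm
    exact tendsto_nhds_unique t1 t2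
  · intro hc
    have : g =ᶠ[𝓝 x] fun _ => g x := by
      filter_upwards [Ioo_mem_nhds (show x - δ₂ < x by linarith)
        (show x < x + δ₁ by linarith)] with y hy
      rcases lt_or_ge y x with h1 | h1
      · rw [hl y ⟨hy.1, h1⟩, hc]
      · exact hr y ⟨h1, hy.2⟩
    exact continuousAt_const.congr this.symm

/-- Near each point a Jordan pair vanishes, or is a single unit mass of one of the two measures,
according to whether the step version is continuous there. This holds for every Jordan pair, so that
the reduced boundary does not depend on the pair. -/
theorem IsJordanDeriv.exists_local {E : Set ℝ} {μ ν : Measure ℝ}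
    (hE : NullMeasurableSet E) (h : IsJordanDeriv E μ ν) {g : ℝ → ℝ} (hg : IsStepVersion g E)
    (x : ℝ) : ∃ δ > 0, ∀ r, 0 < r → r ≤ δ →
      (ContinuousAt g x → (μ + ν) (Metric.ball x r) = 0) ∧
      (¬ ContinuousAt g x →
        (μ.real (Metric.ball x r) = 1 ∧ ν.real (Metric.ball x r) = 0) ∨
        (μ.real (Metric.ball x r) = 0 ∧ ν.real (Metric.ball x r) = 1)) := by
  have := h.locallyFinite_pos
  have := h.locallyFinite_neg
  obtain ⟨g', hg', hinc⟩ := h.exists_isStepVersion hE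
  obtain rfl := hg.unique hg'
  obtain ⟨δ₁, hδ₁, hr⟩ := hg.right x
  obtain ⟨δ₂, hδ₂, c, hl⟩ := hg.left x
  have z1 : ∀ u v : ℝ, ∀ c, (∀ y ∈ Set.Ioo u v, g y = c) →
      μ (Set.Ioo u v) = 0 ∧ ν (Set.Ioo u v) = 0 := by
    intro u v c hc
    have key : ∀ a b, u < a → a ≤ b → b < v → μ.real (Set.Ioc a b) = ν.real (Set.Ioc a b) := by
      intro a b h1 h2 h3
      have := hinc a b h2
      rw [hc a ⟨h1, h2.trans_lt h3⟩, hc b ⟨h1.trans_le h2, h3⟩] at this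
      linarith
    exact ⟨measure_eq_zero_of_eq h.mutuallySingular key,
      measure_eq_zero_of_eq h.mutuallySingular.symm fun a b h1 h2 h3 => (key a b h1 h2 h3).symm⟩
  have zr := z1 x (x + δ₁) (g x) fun y hy => hr y ⟨hy.1.le, hy.2⟩
  have zl := z1 (x - δ₂) x c hl
  have ball_eq : ∀ m : Measure ℝ, m (Set.Ioo (x - δ₂) x) = 0 → m (Set.Ioo x (x + δ₁)) = 0 →
      ∀ r, 0 < r → r ≤ min δ₁ δ₂ → m (Metric.ball x r) = m {x} := by
    intro m h1 h2 r hr0 hr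
    refine le_antisymm ?_ (measure_mono (by simpa using hr0))
    have hsub : Metric.ball x r ⊆ Set.Ioo (x - δ₂) x ∪ {x} ∪ Set.Ioo x (x + δ₁) := by
      rw [Real.ball_eq_Ioo]
      intro y hy
      rcases lt_trichotomy y x with hlt | heq | hgt
      · exact Or.inl (Or.inl ⟨by linarith [hy.1, hr.trans (min_le_right _ _)], hlt⟩)
      · exact Or.inl (Or.inr heq)
      · exact Or.inr ⟨hgt, by linarith [hy.2, hr.trans (min_le_left _ _)]⟩
    calc m (Metric.ball x r) ≤ m (Set.Ioo (x - δ₂) x) + m {x} + m (Set.Ioo x (x + δ₁)) :=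
          (measure_mono hsub).trans ((measure_union_le _ _).trans
            (by gcongr; exact measure_union_le _ _))
      _ = m {x} := by rw [h1, h2]; simp
  have bμ := ball_eq μ zl.1 zr.1
  have bν := ball_eq ν zl.2 zr.2
  -- the jump of `g` at `x`
  have hjump : g x - c = μ.real {x} - ν.real {x} := by
    have e : ∀ m : Measure ℝ, m (Set.Ioo (x - δ₂) x) = 0 →
        m.real (Set.Ioc (x - δ₂ / 2) x) = m.real {x} := by
      intro m hm
      rw [measureReal_def, measureReal_def]
      congr 1
      refine le_antisymm ?_ (measure_mono (by
        rintro y rfl; exact ⟨by linarith, le_rfl⟩))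
      have hsub : Set.Ioc (x - δ₂ / 2) x ⊆ Set.Ioo (x - δ₂) x ∪ {x} := by
        intro y hy
        rcases hy.2.lt_or_eq with hlt | heq
        · exact Or.inl ⟨by linarith [hy.1], hlt⟩
        · exact Or.inr heq
      calc m (Set.Ioc (x - δ₂ / 2) x) ≤ m (Set.Ioo (x - δ₂) x) + m {x} :=
            (measure_mono hsub).trans (measure_union_le _ _)
        _ = m {x} := by rw [hm, zero_add]
    have := hinc (x - δ₂ / 2) x (by linarith)
    rwa [hl (x - δ₂ / 2) ⟨by linarith, by linarith⟩, e μ zl.1, e ν zl.2] at this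
  -- by mutual singularity the jump cannot be a difference of two nonzero masses
  have hsing : μ {x} = 0 ∨ ν {x} = 0 := by
    obtain ⟨s, -, hs1, hs2⟩ := h.mutuallySingular
    by_cases hx : x ∈ s
    · exact Or.inl (measure_mono_null (Set.singleton_subset_iff.2 hx) hs1)
    · exact Or.inr (measure_mono_null (Set.singleton_subset_iff.2 hx) hs2)
  have hcont : ContinuousAt g x ↔ g x = c := continuousAt_iff_of_left_right hδ₁ hr hδ₂ hl
  have hc01 : c = 0 ∨ c = 1 := by
    rw [← hl (x - δ₂ / 2) ⟨by linarith, by linarith⟩]; exact hg.zero_or_one _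
  have fin : ∀ m : Measure ℝ, IsLocallyFiniteMeasure m → m {x} ≠ ⊤ := fun m _ =>
    isCompact_singleton.measure_lt_top.ne
  refine ⟨min δ₁ δ₂, lt_min hδ₁ hδ₂, fun r hr0 hr => ⟨fun hc => ?_, fun hc => ?_⟩⟩
  · rw [hcont.1 hc, sub_self] at hjump
    rw [Measure.add_apply, bμ r hr0 hr, bν r hr0 hr]
    rcases hsing with h0 | h0
    · rw [measureReal_def, h0, ENNReal.toReal_zero, zero_sub, zero_eq_neg,
        measureReal_eq_zero_iff (fin ν inferInstance)] at hjump
      rw [h0, hjump, add_zero]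
    · rw [measureReal_def ν, h0, ENNReal.toReal_zero, sub_zero, eq_comm,
        measureReal_eq_zero_iff (fin μ inferInstance)] at hjump
      rw [h0, hjump, add_zero]
  · rw [hcont] at hc
    rw [measureReal_def, measureReal_def, bμ r hr0 hr, bν r hr0 hr, ← measureReal_def,
      ← measureReal_def]
    have nμ : 0 ≤ μ.real {x} := measureReal_nonneg
    have nν : 0 ≤ ν.real {x} := measureReal_nonneg
    have hs' : μ.real {x} = 0 ∨ ν.real {x} = 0 := hsing.imp
      (fun h => by rw [measureReal_def, h, ENNReal.toReal_zero])
      (fun h => by rw [measureReal_def, h, ENNReal.toReal_zero])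
    rcases hg.zero_or_one x with h1 | h1 <;> rcases hc01 with h2 | h2 <;>
      rw [h1, h2] at hc hjump <;> first | exact absurd rfl hc | skip
    · right; rcases hs' with h | h
      · exact ⟨h, by linarith⟩
      · linarith
    · left; rcases hs' with h | h
      · linarith
      · exact ⟨by linarith, h⟩

theorem reducedBoundary_eq {E : Set ℝ} (hE : LocallyFinitePerimeter E) {g : ℝ → ℝ}
    (hg : IsStepVersion g E) : reducedBoundary E = {x | ¬ ContinuousAt g x} := by
  obtain ⟨hEm, μ, ν, hμν⟩ := hE
  ext x
  constructor
  · rintro ⟨μ', ν', h, hpos, -⟩ hc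
    obtain ⟨δ, hδ, H⟩ := h.exists_local hEm hg x
    exact (hpos δ hδ).ne' ((H δ hδ le_rfl).1 hc)
  · intro hc
    obtain ⟨δ, hδ, H⟩ := hμν.exists_local hEm hg x
    have := hμν.locallyFinite_pos
    have := hμν.locallyFinite_neg
    have hadd : ∀ r, (μ + ν).real (Metric.ball x r) =
        μ.real (Metric.ball x r) + ν.real (Metric.ball x r) := fun r =>
      measureReal_add_apply measure_ball_lt_top.ne measure_ball_lt_top.ne
    refine ⟨μ, ν, hμν, fun r hr => ?_, ?_⟩
    · have hm : 0 < min r δ := lt_min hr hδ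
      have h1 : 0 < (μ + ν).real (Metric.ball x (min r δ)) := by
        rw [hadd]
        rcases (H _ hm (min_le_right _ _)).2 hc with ⟨h, h'⟩ | ⟨h, h'⟩ <;> rw [h, h'] <;> norm_num
      exact (ENNReal.toReal_pos_iff.1 h1).1.trans_le
        (measure_mono (Metric.ball_subset_ball (min_le_left _ _)))
    -- the measure which vanishes on the ball of radius `δ` vanishes on all the smaller ones
    · rcases (H δ hδ le_rfl).2 hc with ⟨h, h'⟩ | ⟨h, h'⟩
      · refine ⟨-1, by simp, tendsto_const_nhds.congr' ?_⟩
        filter_upwards [Ioc_mem_nhdsGT hδ] with r hr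
        have hle : ν.real (Metric.ball x r) ≤ ν.real (Metric.ball x δ) :=
          measureReal_mono (Metric.ball_subset_ball hr.2) measure_ball_lt_top.ne
        rcases (H r hr.1 hr.2).2 hc with ⟨k, k'⟩ | ⟨k, k'⟩
        · rw [hadd, k, k']; norm_num
        · rw [h', k'] at hle; norm_num at hle
      · refine ⟨1, by simp, tendsto_const_nhds.congr' ?_⟩
        filter_upwards [Ioc_mem_nhdsGT hδ] with r hr
        have hle : μ.real (Metric.ball x r) ≤ μ.real (Metric.ball x δ) :=
          measureReal_mono (Metric.ball_subset_ball hr.2) measure_ball_lt_top.ne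
        rcases (H r hr.1 hr.2).2 hc with ⟨k, k'⟩ | ⟨k, k'⟩
        · rw [h, k] at hle; norm_num at hle
        · rw [hadd, k, k']; norm_num

/-! ### Periodic step functions and their jumps -/

theorem ae_comp_add {P : ℝ → Prop} (h : ∀ᵐ x, P x) (z : ℝ) : ∀ᵐ x, P (x + z) :=
  (measurePreserving_add_right volume z).quasiMeasurePreserving.ae h

namespace IsStepVersion

variable {g : ℝ → ℝ} {E : Set ℝ} {L : ℝ}

theorem periodic (h : IsStepVersion g E) (hE : ∀ x, x + L ∈ E ↔ x ∈ E) :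
    Function.Periodic g L := by
  have h' : IsStepVersion (fun x => g (x + L)) E := by
    refine ⟨by have := h.measurable; fun_prop, fun y => h.zero_or_one _, ?_, fun x => ?_, fun x => ?_⟩
    · filter_upwards [ae_comp_add h.ae_eq L] with x hx
      rw [← hx]
      by_cases hx' : x ∈ E
      · simp [chi, hx', (hE x).2 hx']
      · simp [chi, hx', (hE x).not.2 hx']
    · obtain ⟨δ, hδ, H⟩ := h.right (x + L)
      exact ⟨δ, hδ, fun y hy => H _ ⟨by linarith [hy.1], by linarith [hy.2]⟩⟩
    · obtain ⟨δ, hδ, c, H⟩ := h.left (x + L)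
      exact ⟨δ, hδ, c, fun y hy => H _ ⟨by linarith [hy.1], by linarith [hy.2]⟩⟩
  exact fun x => congrFun (h'.unique h) x

theorem finite_jumps (h : IsStepVersion g E) (a b : ℝ) :
    ({x | ¬ ContinuousAt g x} ∩ Set.Ico a b).Finite := by
  choose δ hδ hr using h.right
  choose δ' hδ' c hl using h.left
  obtain ⟨t, -, ht⟩ := (isCompact_Icc (a := a) (b := b)).elim_nhds_subcover
    (fun x => Set.Ioo (x - δ' x) (x + δ x))
    (fun x _ => Ioo_mem_nhds (by linarith [hδ' x]) (by linarith [hδ x]))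
  refine t.finite_toSet.subset ?_
  rintro y ⟨hy, hyI⟩
  obtain ⟨x, hxt, hxy⟩ := Set.mem_iUnion₂.1 (ht (Set.Ico_subset_Icc_self hyI))
  have : y = x := by
    by_contra hne
    refine hy ?_
    rcases lt_or_gt_of_ne hne with hlt | hgt
    · have : g =ᶠ[𝓝 y] fun _ => c x := by
        filter_upwards [Ioo_mem_nhds hxy.1 hlt] with w hw
        exact hl x w hw
      exact continuousAt_const.congr this.symm
    · have : g =ᶠ[𝓝 y] fun _ => g x := by
        filter_upwards [Ioo_mem_nhds hgt hxy.2] with w hw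
        exact hr x w ⟨hw.1.le, hw.2⟩
      exact continuousAt_const.congr this.symm
  rw [this]; exact hxt

theorem eq_of_continuousAt (h : IsStepVersion g E) {a b : ℝ}
    (hc : ∀ y ∈ Set.Ioo a b, ContinuousAt g y) {y : ℝ} (hy : y ∈ Set.Ico a b) : g y = g a := by
  have hcont : ContinuousOn g (Set.Ico a b) := by
    intro w hw
    rcases hw.1.eq_or_lt with rfl | hlt
    · obtain ⟨δ, hδ, hr⟩ := h.right a
      have : g =ᶠ[𝓝[Set.Ico a b] a] fun _ => g a := by
        filter_upwards [mem_nhdsWithin_of_mem_nhds (Iio_mem_nhds (show a < a + δ by linarith)),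
          self_mem_nhdsWithin] with v hv hv'
        exact hr v ⟨hv'.1, hv⟩
      exact continuousWithinAt_const.congr_of_eventuallyEq this rfl
    · exact (hc w ⟨hlt, hw.2⟩).continuousWithinAt
  have hmaps : Set.MapsTo g (Set.Ico a b) ({0, 1} : Set ℝ) := fun w _ => h.zero_or_one w
  have hdisc : IsDiscrete ({0, 1} : Set ℝ) := ((Set.finite_singleton (1 : ℝ)).insert 0).isDiscrete
  exact isPreconnected_Ico.constant_of_mapsTo hdisc hcont hmaps hy ⟨le_rfl, hy.1.trans_lt hy.2⟩

theorem const_of_continuous (h : IsStepVersion g E) (hc : ∀ y, ContinuousAt g y) (y : ℝ) :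
    g y = g 0 := by
  rcases le_total 0 y with hy | hy
  · exact h.eq_of_continuousAt (a := 0) (b := y + 1) (fun w _ => hc w) ⟨hy, by linarith⟩
  · exact (h.eq_of_continuousAt (a := y) (b := 1) (fun w _ => hc w) ⟨hy, one_pos⟩).symm

theorem continuousAt_add_period (hp : Function.Periodic g L) {y : ℝ} :
    ContinuousAt g (y + L) ↔ ContinuousAt g y := by
  have e : g ∘ (fun x => x + L) = g := funext hp
  constructor
  · intro h
    have : ContinuousAt (g ∘ fun x => x + L) y :=
      ContinuousAt.comp (f := fun x => x + L) h (by fun_prop)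
    rwa [e] at this
  · intro h
    have e' : g ∘ (fun x => x - L) = g := funext fun x => hp.sub_eq x
    have : ContinuousAt (g ∘ fun x => x - L) (y + L) :=
      ContinuousAt.comp (f := fun x => x - L) (by simpa using h) (by fun_prop)
    rwa [e'] at this

theorem flip_of_not_continuousAt (h : IsStepVersion g E) {a b : ℝ} (hab : a < b)
    (hc : ∀ y ∈ Set.Ioo a b, ContinuousAt g y) (hb : ¬ ContinuousAt g b) : g b = 1 - g a := by
  obtain ⟨δ, hδ, hr⟩ := h.right b
  have := continuousAt_iff_of_left_right hδ hr (δ₂ := b - a) (c := g a) (by linarith)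
    fun y hy => h.eq_of_continuousAt hc ⟨by linarith [hy.1], hy.2⟩
  rw [this] at hb
  rcases h.zero_or_one a with h1 | h1 <;> rcases h.zero_or_one b with h2 | h2 <;>
    first | exact absurd (h2.trans h1.symm) hb | (rw [h1, h2]; norm_num)

/-- The discontinuities in `[0, L)`, in increasing order and followed by the first one shifted by
`L`, form a jump profile. -/
theorem exists_isJumpProfile (h : IsStepVersion g E) (hp : Function.Periodic g L) {N : ℕ}
    (hN : 0 < N) (hcard : ({x | ¬ ContinuousAt g x} ∩ Set.Ico 0 L).ncard = N) :
    ∃ x, IsJumpProfile g L N x := by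
  have hfin := h.finite_jumps 0 L
  set S : Finset ℝ := hfin.toFinset with hS
  have hSc : S.card = N := by rw [← hcard, Set.ncard_eq_toFinset_card _ hfin]
  set s := S.orderEmbOfFin hSc
  have hmem : ∀ i, ¬ ContinuousAt g (s i) ∧ s i ∈ Set.Ico 0 L := fun i => by
    exact hfin.mem_toFinset.1 (S.orderEmbOfFin_mem hSc i)
  have hsurj : ∀ y, ¬ ContinuousAt g y → y ∈ Set.Ico 0 L → ∃ i, s i = y := fun y h1 h2 => by
    have : y ∈ Set.range s := by
      rw [Finset.range_orderEmbOfFin]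
      simpa [hS] using ⟨h1, h2.1, h2.2⟩
    exact this
  set x : ℕ → ℝ := fun i => if hi : i < N then s ⟨i, hi⟩ else s ⟨0, hN⟩ + L with hx
  have x_lt : ∀ i (hi : i < N), x i = s ⟨i, hi⟩ := fun i hi => by simp [hx, hi]
  have xN : x N = s ⟨0, hN⟩ + L := by simp [hx]
  have hlt : ∀ i < N, x i < x (i + 1) := by
    intro i hi
    rcases Nat.lt_or_ge (i + 1) N with h1 | h1
    · rw [x_lt i hi, x_lt _ h1]
      exact s.strictMono (by simp [Fin.lt_def])
    · rw [show i + 1 = N by omega, x_lt i hi, xN]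
      linarith [(hmem ⟨i, hi⟩).2.2, (hmem ⟨0, hN⟩).2.1]
  have hcont : ∀ i < N, ∀ y ∈ Set.Ioo (x i) (x (i + 1)), ContinuousAt g y := by
    intro i hi y hy
    by_contra hcon
    rcases Nat.lt_or_ge (i + 1) N with h1 | h1
    · rw [x_lt i hi, x_lt _ h1] at hy
      obtain ⟨j, rfl⟩ := hsurj y hcon
        ⟨(hmem ⟨i, hi⟩).2.1.trans hy.1.le, hy.2.trans (hmem ⟨i + 1, h1⟩).2.2⟩
      have k1 := s.lt_iff_lt.1 hy.1
      have k2 := s.lt_iff_lt.1 hy.2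
      rw [Fin.lt_def] at k1 k2
      simp only at k1 k2
      omega
    · rw [show i + 1 = N by omega, x_lt i hi, xN] at hy
      rcases lt_or_ge y L with hyL | hyL
      · obtain ⟨j, rfl⟩ := hsurj y hcon ⟨(hmem ⟨i, hi⟩).2.1.trans hy.1.le, hyL⟩
        have k1 := s.lt_iff_lt.1 hy.1
        rw [Fin.lt_def] at k1
        simp only at k1
        omega
      -- a jump in `[L, x N)` would give one in `[0, x 0)`
      · have hcon' : ¬ ContinuousAt g (y - L) := by
          rw [← continuousAt_add_period hp, sub_add_cancel]; exact hcon
        obtain ⟨j, hj⟩ := hsurj (y - L) hcon'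
          ⟨by linarith, by linarith [hy.2, (hmem ⟨0, hN⟩).2.2]⟩
        have k1 : s j < s ⟨0, hN⟩ := by rw [hj]; linarith [hy.2]
        have k2 := s.lt_iff_lt.1 k1
        rw [Fin.lt_def] at k2
        simp only at k2
        omega
  have hjump : ∀ i < N, ¬ ContinuousAt g (x (i + 1)) := by
    intro i hi
    rcases Nat.lt_or_ge (i + 1) N with h1 | h1
    · rw [x_lt _ h1]; exact (hmem _).1
    · rw [show i + 1 = N by omega, xN, continuousAt_add_period hp]; exact (hmem _).1
  exact ⟨x, h.measurable, h.zero_or_one, hp, hlt,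
    fun i hi y hy => h.eq_of_continuousAt (hcont i hi) hy,
    fun i hi => h.flip_of_not_continuousAt (hlt i hi) (hcont i hi) (hjump i hi),
    by rw [xN, x_lt 0 hN]⟩

theorem energy_eq (h : IsStepVersion g E) (hE : LocallyFinitePerimeter E) (k : ℝ → ℝ) (L : ℝ) :
    energy k L E = 1 / L * (-(({x | ¬ ContinuousAt g x} ∩ Set.Ico 0 L).ncard : ℝ) +
      ∫ z, k z * ((({x | ¬ ContinuousAt g x} ∩ Set.Ico 0 L).ncard : ℝ) * |z| -
        mismatch g L z)) := by
  have e : ∀ z, ∫ x in (0 : ℝ)..L, |chi E x - chi E (x + z)| = mismatch g L z := by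
    intro z
    refine intervalIntegral.integral_congr_ae ?_
    filter_upwards [h.ae_eq, ae_comp_add h.ae_eq z] with x h1 h2 _
    rw [h1, h2]
  simp only [energy, perimeter, e, reducedBoundary_eq hE h]

theorem ae_eq_of_ae_eq_chi {E' : Set ℝ} (h : IsStepVersion g E) (h' : chi E' =ᵐ[volume] g) :
    E =ᵐ[volume] E' := by
  filter_upwards [h.ae_eq, h'] with x h1 h2
  have h3 : chi E x = chi E' x := h1.trans h2.symm
  refine propext ⟨fun hx => ?_, fun hx => ?_⟩
  · by_contra hx'
    rw [chi, chi, Set.indicator_of_mem hx, Set.indicator_of_notMem hx'] at h3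
    exact one_ne_zero h3
  · by_contra hx'
    rw [chi, chi, Set.indicator_of_mem hx, Set.indicator_of_notMem hx'] at h3
    exact one_ne_zero h3.symm

end IsStepVersion

theorem chi_stripes_ae_eq {h : ℝ} (hh : 0 < h) (ν : ℝ) :
    chi (stripes h ν) =ᵐ[volume] fun y => stripeProfile h (y - ν) := by
  have hcount : (Set.range fun n : ℤ => (n : ℝ) * h + ν).Countable := Set.countable_range _
  filter_upwards [hcount.ae_notMem volume] with y hy
  have hne : ∀ n : ℤ, y ≠ n * h + ν := fun n hn => hy ⟨n, hn.symm⟩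
  have hfl := Int.floor_eq_iff.1 (rfl : ⌊(y - ν) / h⌋ = _)
  rw [le_div_iff₀ hh, div_lt_iff₀ hh] at hfl
  set n := ⌊(y - ν) / h⌋ with hn
  rw [stripeProfile_of_mem hh (n := n) ⟨hfl.1, hfl.2⟩]
  by_cases hev : Even n
  · rw [if_pos hev, chi, Set.indicator_of_mem]
    obtain ⟨m, hm⟩ := hev
    refine Set.mem_iUnion.2 ⟨m, ?_, ?_⟩
    · have : (n : ℝ) = 2 * m := by rw [hm]; push_cast; ring
      rw [← this]; linarith [hfl.1]
    · have : (n : ℝ) = 2 * m := by rw [hm]; push_cast; ring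
      rw [← this]; linarith [hfl.2]
  · rw [if_neg hev, chi, Set.indicator_of_notMem]
    intro hmem
    obtain ⟨m, h1, h2⟩ := Set.mem_iUnion.1 hmem
    have h3 : y < ((2 * m + 1 : ℤ) : ℝ) * h + ν :=
      lt_of_le_of_ne (by push_cast; exact h2) (hne _)
    push_cast at h3
    have : n = 2 * m := by
      rw [hn, Int.floor_eq_iff, le_div_iff₀ hh, div_lt_iff₀ hh]
      push_cast
      constructor <;> linarith
    exact hev ⟨m, by rw [this]; ring⟩

theorem stripeProfile_left {h : ℝ} (hh : 0 < h) (n : ℤ) {y : ℝ}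
    (hy : y ∈ Set.Ioo (n * h - h) (n * h)) :
    stripeProfile h y = if Even n then 0 else 1 := by
  rw [stripeProfile_of_mem hh (n := n - 1)
    ⟨by push_cast; linarith [hy.1], by push_cast; linarith [hy.2]⟩]
  by_cases hn : Even n
  · have : ¬ Even (n - 1) := by
      rw [Int.not_even_iff_odd]; exact hn.sub_odd odd_one
    simp [hn, this]
  · have : Even (n - 1) := (Int.not_even_iff_odd.1 hn).sub_odd odd_one
    simp [hn, this]

theorem isStepVersion_stripeProfile {h : ℝ} (hh : 0 < h) :
    IsStepVersion (stripeProfile h) (stripes h 0) where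
  measurable := (isJumpProfile_stripeProfile hh 1).measurable
  zero_or_one := (isJumpProfile_stripeProfile hh 1).zero_or_one
  ae_eq := by simpa using chi_stripes_ae_eq hh 0
  right x := by
    have hfl := Int.floor_eq_iff.1 (rfl : ⌊x / h⌋ = _)
    rw [le_div_iff₀ hh, div_lt_iff₀ hh] at hfl
    refine ⟨(⌊x / h⌋ + 1) * h - x, by linarith, fun y hy => ?_⟩
    rw [stripeProfile_of_mem hh ⟨hfl.1.trans hy.1, by linarith [hy.2]⟩,
      stripeProfile_of_mem hh ⟨hfl.1, hfl.2⟩]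
  left x := by
    have hce := Int.ceil_eq_iff.1 (rfl : ⌈x / h⌉ = _)
    rw [lt_div_iff₀ hh, div_le_iff₀ hh] at hce
    refine ⟨x - (⌈x / h⌉ - 1) * h, by linarith, _, fun y hy =>
      stripeProfile_left hh ⌈x / h⌉ ⟨by linarith [hy.1], by linarith [hy.2]⟩⟩

theorem continuousAt_stripeProfile_iff {h : ℝ} (hh : 0 < h) {y : ℝ} :
    ContinuousAt (stripeProfile h) y ↔ ∀ n : ℤ, y ≠ n * h := by
  constructor
  · rintro hc n rfl
    rw [continuousAt_iff_of_left_right hh (δ₂ := h) (c := if Even n then 0 else 1) ?_ hh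
      fun y hy => stripeProfile_left hh n hy] at hc
    · rw [stripeProfile_of_mem hh (n := n) ⟨le_rfl, by linarith⟩] at hc
      split_ifs at hc <;> norm_num at hc
    · intro y hy
      rw [stripeProfile_of_mem hh (n := n) ⟨hy.1, by linarith [hy.2]⟩,
        stripeProfile_of_mem hh (n := n) ⟨le_rfl, by linarith⟩]
  · intro hne
    have hfl := Int.floor_eq_iff.1 (rfl : ⌊y / h⌋ = _)
    rw [le_div_iff₀ hh, div_lt_iff₀ hh] at hfl
    have hlt : ⌊y / h⌋ * h < y := lt_of_le_of_ne hfl.1 (hne _).symm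
    have : stripeProfile h =ᶠ[𝓝 y] fun _ => if Even ⌊y / h⌋ then 1 else 0 := by
      filter_upwards [Ioo_mem_nhds hlt hfl.2] with w hw
      exact stripeProfile_of_mem hh ⟨hw.1.le, hw.2⟩
    exact continuousAt_const.congr this.symm

theorem ncard_jumps_stripeProfile {h : ℝ} (hh : 0 < h) (M : ℕ) :
    ({x | ¬ ContinuousAt (stripeProfile h) x} ∩ Set.Ico 0 (2 * M * h)).ncard = 2 * M := by
  have e : {x | ¬ ContinuousAt (stripeProfile h) x} ∩ Set.Ico 0 (2 * M * h) =
      ((Finset.range (2 * M)).image fun i : ℕ => (i : ℝ) * h : Finset ℝ) := by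
    ext y
    simp only [Set.mem_inter_iff, Set.mem_ofPred_eq, continuousAt_stripeProfile_iff hh,
      Finset.coe_image, Set.mem_image, Finset.coe_range, Set.mem_Iio, not_forall, not_not,
      Set.mem_Ico]
    constructor
    · rintro ⟨⟨n, rfl⟩, h0, h1⟩
      have h0' : 0 ≤ n := by
        by_contra! hn
        have : (n : ℝ) < 0 := by exact_mod_cast hn
        nlinarith
      lift n to ℕ using h0'
      refine ⟨n, ?_, by simp⟩
      have := lt_of_mul_lt_mul_right h1 hh.le
      push_cast at this
      exact_mod_cast this
    · rintro ⟨i, hi, rfl⟩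
      refine ⟨⟨i, by simp⟩, by positivity, ?_⟩
      have : (i : ℝ) < 2 * M := by exact_mod_cast hi
      gcongr
  rw [e, Set.ncard_coe_finset, Finset.card_image_of_injective _ fun a b hab => by
    have := mul_right_cancel₀ hh.ne' hab
    exact_mod_cast this, Finset.card_range]

namespace IsJumpProfile

variable {g : ℝ → ℝ} {L : ℝ} {N : ℕ} {x : ℕ → ℝ}

theorem apply_jump (h : IsJumpProfile g L N x) {i : ℕ} (hi : i ≤ N) :
    g (x i) = if Even i then g (x 0) else 1 - g (x 0) := by
  induction i with
  | zero => simp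
  | succ i ih =>
    rw [h.flip i hi, ih (by omega)]
    by_cases hev : Even i <;> simp [Nat.even_add_one, hev]

theorem even (h : IsJumpProfile g L N x) : Even N := by
  by_contra hN
  have := h.apply_jump le_rfl
  rw [if_neg hN, h.wrap, h.periodic] at this
  rcases h.zero_or_one (x 0) with h0 | h0 <;> rw [h0] at this <;> norm_num at this

theorem sum_gaps (h : IsJumpProfile g L N x) :
    ∑ i ∈ Finset.range N, (x (i + 1) - x i) = L := by
  rw [Finset.sum_range_sub, h.wrap]; ring

/-- With equal gaps, the values of `g` alternate on intervals of equal length. -/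
theorem exists_eq_stripeProfile (h : IsJumpProfile g L N x) (hN : 0 < N) {ℓ : ℝ}
    (hgap : ∀ i < N, x (i + 1) - x i = ℓ) :
    ∃ ν, ∀ y, g y = stripeProfile ℓ (y - ν) := by
  have hℓ : 0 < ℓ := by rw [← hgap 0 hN]; exact sub_pos.2 (h.lt 0 hN)
  have hL : L = N * ℓ := by
    rw [← h.sum_gaps, Finset.sum_congr rfl fun i hi => hgap i (Finset.mem_range.1 hi)]; simp
  have hLpos : 0 < L := by rw [hL]; positivity
  have hx : ∀ i ≤ N, x i = x 0 + i * ℓ := by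
    intro i hi
    induction i with
    | zero => simp
    | succ i ih =>
      have := hgap i hi
      rw [ih (by omega)] at this
      push_cast; linarith
  obtain ⟨M, hM⟩ := h.even
  have hMr : (N : ℝ) = 2 * M := by rw [hM]; push_cast; ring
  have hper : Function.Periodic (stripeProfile ℓ) L := by
    rw [hL, hMr]; exact (isJumpProfile_stripeProfile hℓ M).periodic
  -- on one period, `g` is determined by its value at the first jump
  have hfund : ∀ y ∈ Set.Ico (x 0) (x 0 + L), ∃ i : ℕ, i < N ∧
      y - x 0 ∈ Set.Ico ((i : ℤ) * ℓ) (((i : ℤ) + 1) * ℓ) ∧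
      g y = if Even i then g (x 0) else 1 - g (x 0) := by
    intro y hy
    have hnn : 0 ≤ (y - x 0) / ℓ := div_nonneg (by linarith [hy.1]) hℓ.le
    have h1 := Nat.floor_le hnn
    have h2 := Nat.lt_floor_add_one ((y - x 0) / ℓ)
    set i := ⌊(y - x 0) / ℓ⌋₊
    rw [le_div_iff₀ hℓ] at h1
    rw [div_lt_iff₀ hℓ] at h2
    have hi : i < N := by
      have : (i : ℝ) * ℓ < N * ℓ := by linarith [hy.2]
      exact_mod_cast lt_of_mul_lt_mul_right this hℓ.le
    refine ⟨i, hi, ⟨by push_cast; exact h1, by push_cast; exact h2⟩, ?_⟩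
    rw [h.const i hi y ⟨by rw [hx i hi.le]; linarith, by rw [hx _ hi]; push_cast; linarith⟩,
      h.apply_jump hi.le]
  -- hence the identity extends from one period to the whole line
  have hext : ∀ ν, (∀ y ∈ Set.Ico (x 0) (x 0 + L), g y = stripeProfile ℓ (y - ν)) →
      ∀ y, g y = stripeProfile ℓ (y - ν) := by
    intro ν H y
    have h1 := toIcoMod_mem_Ico hLpos (x 0) y
    have h2 := H _ h1
    rw [← self_sub_toIcoDiv_zsmul, h.periodic.sub_zsmul_eq] at h2
    rw [h2, sub_right_comm, hper.sub_zsmul_eq]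
  rcases h.zero_or_one (x 0) with h0 | h0
  · refine ⟨x 0 + ℓ, hext _ fun y hy => ?_⟩
    obtain ⟨i, -, hmem, hgy⟩ := hfund y hy
    rw [hgy, stripeProfile_of_mem hℓ (n := (i : ℤ) - 1)
      ⟨by push_cast at hmem ⊢; linarith [hmem.1], by push_cast at hmem ⊢; linarith [hmem.2]⟩, h0]
    by_cases hev : Even i
    · have : ¬ Even ((i : ℤ) - 1) := by
        rw [Int.not_even_iff_odd]; exact ((Int.even_coe_nat i).2 hev).sub_odd odd_one
      simp [hev, this]
    · have : Even ((i : ℤ) - 1) := by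
        refine Odd.sub_odd ?_ odd_one
        rw [← Int.not_even_iff_odd, Int.even_coe_nat]; exact hev
      simp [hev, this]
  · refine ⟨x 0, hext _ fun y hy => ?_⟩
    obtain ⟨i, -, hmem, hgy⟩ := hfund y hy
    rw [hgy, stripeProfile_of_mem hℓ (n := (i : ℤ)) hmem, h0]
    simp [Int.even_coe_nat]

end IsJumpProfile

/-! ### Stripes as admissible sets, and the one-dimensional minimization -/

theorem isJordanDeriv_zero {E : Set ℝ} (h : ∀ φ : ℝ → ℝ, ContDiff ℝ (⊤ : ℕ∞) φ →
    HasCompactSupport φ → ∫ x in E, deriv φ x = 0) : IsJordanDeriv E 0 0 where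
  locallyFinite_pos := inferInstance
  locallyFinite_neg := inferInstance
  mutuallySingular := Measure.MutuallySingular.zero_right
  integral_deriv φ h1 h2 := by rw [h φ h1 h2]; simp

theorem periodicFinitePerimeter_empty (L : ℝ) : PeriodicFinitePerimeter L ∅ :=
  ⟨⟨MeasurableSet.empty.nullMeasurableSet, 0, 0, isJordanDeriv_zero fun φ _ _ => by simp⟩, by simp⟩

/-- The sum of the unit masses at the points `2 n h + a`, `n ∈ ℤ`. -/
def combMeasure (a h : ℝ) : Measure ℝ :=
  Measure.sum fun n : ℤ => (1 : ENNReal) • Measure.dirac (2 * n * h + a)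

section

variable {a h : ℝ}

theorem finite_comb (hh : 0 < h) (a u v : ℝ) :
    {n : ℤ | 2 * n * h + a ∈ Set.Ioo u v}.Finite := by
  refine (Set.finite_Icc ⌊(u - a) / (2 * h)⌋ ⌈(v - a) / (2 * h)⌉).subset fun n hn => ⟨?_, ?_⟩
  · have h1 : (u - a) / (2 * h) ≤ n := by
      rw [div_le_iff₀ (by positivity)]; linarith [hn.1]
    exact_mod_cast (Int.floor_le _).trans h1
  · have h1 : (n : ℝ) ≤ (v - a) / (2 * h) := by
      rw [le_div_iff₀ (by positivity)]; linarith [hn.2]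
    exact_mod_cast h1.trans (Int.le_ceil _)

theorem combMeasure_apply {s : Set ℝ} (hs : MeasurableSet s) :
    combMeasure a h s = ∑' n : ℤ, s.indicator 1 (2 * n * h + a) := by
  rw [combMeasure, Measure.sum_apply _ hs]
  simp [Measure.dirac_apply' _ hs]

theorem isLocallyFiniteMeasure_combMeasure (hh : 0 < h) :
    IsLocallyFiniteMeasure (combMeasure a h) := by
  refine ⟨fun x => ⟨Set.Ioo (x - 1) (x + 1), Ioo_mem_nhds (by linarith) (by linarith), ?_⟩⟩
  rw [combMeasure_apply measurableSet_Ioo,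
    tsum_eq_sum (s := (finite_comb hh a (x - 1) (x + 1)).toFinset) fun n hn => ?_]
  · refine ENNReal.sum_lt_top.2 fun n _ => ?_
    exact (Set.indicator_le_self _ _ _).trans_lt (by simp)
  · refine Set.indicator_of_notMem (fun hmem => hn ?_) _
    exact (Set.Finite.mem_toFinset _).2 hmem

theorem combMeasure_eq_zero {s : Set ℝ} (hs : MeasurableSet s)
    (h0 : ∀ n : ℤ, 2 * n * h + a ∉ s) : combMeasure a h s = 0 := by
  rw [combMeasure_apply hs, ENNReal.tsum_eq_zero]
  exact fun n => Set.indicator_of_notMem (h0 n) _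

theorem integral_combMeasure (φ : ℝ → ℝ) :
    ∫ x, φ x ∂combMeasure a h = ∑' n : ℤ, φ (2 * n * h + a) := by
  rw [combMeasure, integral_sum_dirac (fun _ => ENNReal.one_ne_top)]
  simp

theorem summable_comb (hh : 0 < h) {φ : ℝ → ℝ} (hc : HasCompactSupport φ) :
    Summable fun n : ℤ => φ (2 * n * h + a) := by
  obtain ⟨R, -, hsupp⟩ := exists_tsupport_subset_Ioo hc
  refine summable_of_hasFiniteSupport ((finite_comb hh a (-R) R).subset fun n hn => ?_)
  exact hsupp (subset_tsupport _ hn)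

theorem integral_stripes_deriv (hh : 0 < h) {φ : ℝ → ℝ} (hφ : ContDiff ℝ (⊤ : ℕ∞) φ)
    (hc : HasCompactSupport φ) :
    ∫ x in stripes h 0, deriv φ x =
      -(∑' n : ℤ, φ (2 * n * h + 0) - ∑' n : ℤ, φ (2 * n * h + h)) := by
  have hdc : Continuous (deriv φ) := hφ.continuous_deriv (by simp)
  have hdint : Integrable (deriv φ) := hdc.integrable_of_hasCompactSupport hc.deriv
  have hdisj : Pairwise (Function.onFun Disjoint fun n : ℤ =>
      Set.Icc (2 * n * h + 0) ((2 * n + 1) * h + 0)) := by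
    have key : ∀ m n : ℤ, m < n → Disjoint (Set.Icc (2 * m * h + 0) ((2 * m + 1) * h + 0))
        (Set.Icc (2 * n * h + 0) ((2 * n + 1) * h + 0)) := by
      intro m n hmn
      rw [Set.disjoint_left]
      intro y hy hy'
      have h1 : (m : ℝ) + 1 ≤ n := by exact_mod_cast hmn
      have h2 := hy.2
      have h3 := hy'.1
      nlinarith
    intro m n hmn
    rcases lt_or_gt_of_ne hmn with h1 | h1
    · exact key m n h1
    · exact (key n m h1).symm
  rw [stripes, integral_iUnion (fun n => measurableSet_Icc) hdisj hdint.integrableOn,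
    ← (summable_comb hh hc).tsum_sub (summable_comb hh hc), ← tsum_neg]
  refine tsum_congr fun n => ?_
  rw [integral_Icc_eq_integral_Ioc, ← intervalIntegral.integral_of_le (by nlinarith),
    intervalIntegral.integral_deriv_eq_sub
      (fun x _ => (hφ.differentiable (by simp)).differentiableAt) (hdc.intervalIntegrable _ _),
    show (2 * (n : ℝ) + 1) * h + 0 = 2 * n * h + h by ring]
  ring

theorem isJordanDeriv_stripes (hh : 0 < h) :
    IsJordanDeriv (stripes h 0) (combMeasure 0 h) (combMeasure h h) where
  locallyFinite_pos := isLocallyFiniteMeasure_combMeasure hh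
  locallyFinite_neg := isLocallyFiniteMeasure_combMeasure hh
  mutuallySingular := by
    have hcount : (Set.range fun n : ℤ => 2 * (n : ℝ) * h + h).Countable := Set.countable_range _
    refine ⟨Set.range fun n : ℤ => 2 * (n : ℝ) * h + h, hcount.measurableSet, ?_, ?_⟩
    · refine combMeasure_eq_zero hcount.measurableSet fun n hn => ?_
      obtain ⟨m, hm⟩ := hn
      have h1 : (2 * (m : ℝ) + 1) * h = (2 * n) * h := by linarith
      have h2 : 2 * m + 1 = 2 * n := by exact_mod_cast mul_right_cancel₀ hh.ne' h1
      omega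
    · exact combMeasure_eq_zero hcount.measurableSet.compl fun n hn => hn ⟨n, rfl⟩
  integral_deriv φ hφ hc := by
    rw [integral_combMeasure, integral_combMeasure, integral_stripes_deriv hh hφ hc]

theorem mem_stripes_add_iff (h : ℝ) (M : ℕ) (x : ℝ) :
    x + 2 * M * h ∈ stripes h 0 ↔ x ∈ stripes h 0 := by
  simp only [stripes, Set.mem_iUnion, Set.mem_Icc]
  constructor
  · rintro ⟨n, h1, h2⟩
    refine ⟨n - M, ?_, ?_⟩ <;> push_cast <;> linarith
  · rintro ⟨n, h1, h2⟩
    refine ⟨n + M, ?_, ?_⟩ <;> push_cast <;> linarith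

theorem periodicFinitePerimeter_stripes (hh : 0 < h) (M : ℕ) :
    PeriodicFinitePerimeter (2 * M * h) (stripes h 0) :=
  ⟨⟨(MeasurableSet.iUnion fun _ => measurableSet_Icc).nullMeasurableSet, _, _,
    isJordanDeriv_stripes hh⟩, mem_stripes_add_iff h M⟩

end

section

variable {f k : ℝ → ℝ} {c q L : ℝ}

theorem energy_stripes (hk : IsLaplaceKernel f k c q) {h : ℝ} (hh : 0 < h) {M : ℕ} (hM : 0 < M) :
    energy k (2 * M * h) (stripes h 0) = (stripePotential f h - 1) / h := by
  rw [(isStepVersion_stripeProfile hh).energy_eq (periodicFinitePerimeter_stripes hh M).1,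
    ncard_jumps_stripeProfile hh M,
    ((isJumpProfile_stripeProfile hh M).integrableOn_and_integral_of_gap hk (by positivity)
      fun i _ => by push_cast; ring).2]
  have hM' : (0 : ℝ) < M := by exact_mod_cast hM
  push_cast
  field_simp
  ring

/-- A periodic set of locally finite perimeter is trivial and has energy zero, or its energy is
bounded below by the sum over its gaps. -/
theorem energy_eq_zero_or_exists_isJumpProfile (hk : IsLaplaceKernel f k c q) (hL : 0 < L) {E : Set ℝ}
    (hE : PeriodicFinitePerimeter L E) :
    (energy k L E = 0 ∧ (E =ᵐ[volume] (∅ : Set ℝ) ∨ E =ᵐ[volume] (Set.univ : Set ℝ))) ∨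
    ∃ N : ℕ, ∃ x : ℕ → ℝ, ∃ g : ℝ → ℝ, 0 < N ∧ IsStepVersion g E ∧ IsJumpProfile g L N x ∧
      1 / L * ∑ i ∈ Finset.range N, (stripePotential f (x (i + 1) - x i) - 1) ≤ energy k L E := by
  obtain ⟨g, hg⟩ := hE.1.exists_isStepVersion
  have hp := hg.periodic hE.2
  have hen := hg.energy_eq hE.1 k L
  set N := ({x | ¬ ContinuousAt g x} ∩ Set.Ico 0 L).ncard with hN
  rcases N.eq_zero_or_pos with h0 | hpos
  · left
    have hc : ∀ y, ContinuousAt g y := by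
      intro y
      by_contra hcon
      have hempty := (Set.ncard_eq_zero (hg.finite_jumps 0 L)).1 (hN.symm.trans h0)
      have hmem : toIcoMod hL 0 y ∈ {x | ¬ ContinuousAt g x} ∩ Set.Ico 0 L := by
        refine ⟨fun hcont => hcon ?_, by simpa using toIcoMod_mem_Ico hL 0 y⟩
        have hp' := hp.zsmul (toIcoDiv hL 0 y)
        rwa [← IsStepVersion.continuousAt_add_period hp', toIcoMod_add_toIcoDiv_zsmul] at hcont
      rw [hempty] at hmem
      exact hmem
    have hconst := hg.const_of_continuous hc
    refine ⟨?_, ?_⟩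
    · have hm : ∀ z, mismatch g L z = 0 := fun z => by
        simp [mismatch, hconst]
      rw [hen, h0]
      simp [hm]
    · rcases hg.zero_or_one 0 with h1 | h1
      · left
        refine hg.ae_eq_of_ae_eq_chi (Eventually.of_forall fun y => ?_)
        rw [hconst, h1]; simp [chi]
      · right
        refine hg.ae_eq_of_ae_eq_chi (Eventually.of_forall fun y => ?_)
        rw [hconst, h1]; simp [chi]
  · right
    obtain ⟨x, hx⟩ := hg.exists_isJumpProfile hp hpos hN.symm
    refine ⟨N, x, g, hpos, hg, hx, ?_⟩
    rw [hen]
    have := hx.sum_stripePotential_le hk hL.le fun ℓ hℓ => hk.integrableOn_mul_stripeWeight hℓ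
    gcongr
    rw [Finset.sum_sub_distrib]
    simp only [Finset.sum_const, Finset.card_range, nsmul_eq_mul, mul_one]
    linarith

theorem IsJumpProfile.isPeriodicStripes {g : ℝ → ℝ} {E : Set ℝ} {N : ℕ} {x : ℕ → ℝ}
    (h : IsJumpProfile g L N x) (hg : IsStepVersion g E) (hN : 0 < N) {ℓ : ℝ}
    (hgap : ∀ i < N, x (i + 1) - x i = ℓ) : IsPeriodicStripes ℓ E := by
  have hℓ : 0 < ℓ := by rw [← hgap 0 hN]; exact sub_pos.2 (h.lt 0 hN)
  obtain ⟨ν, hν⟩ := h.exists_eq_stripeProfile hN hgap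
  refine ⟨hℓ, ν, hg.ae_eq_of_ae_eq_chi ?_⟩
  rw [show g = fun y => stripeProfile ℓ (y - ν) from funext hν]
  exact chi_stripes_ae_eq hℓ ν

/-- The one-dimensional problem for a fixed kernel. The constants depend on the kernel only through
the bound `4 c ≤ h₀`, which makes stripes of width `h₀` have energy density at most `-1 / (2 h₀)`;
the bound at `h₁` makes the energy of thin stripes positive. -/
theorem exists_optimal_of_isLaplaceKernel (hk : IsLaplaceKernel f k c q) {h₀ h₁ : ℝ}
    (hh₀ : 1 ≤ h₀) (hch₀ : 4 * c ≤ h₀) (hh₁ : 0 < h₁) (hkh₁ : 1 < h₁ ^ 2 * k (2 * h₁)) :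
    ∃ s, IsOptimalPeriod k s ∧ ∀ L, 0 < L → (∃ E, IsMinimizer k L E) ∧
      ∀ E, IsMinimizer k L E →
        (∃ h, IsPeriodicStripes h E ∧ |h - s| ≤ (32 * h₀ ^ 2 + 2 * h₀) / L) ∨
        (L ≤ 32 * h₀ ^ 2 + 2 * h₀ ∧
          (E =ᵐ[volume] (∅ : Set ℝ) ∨ E =ᵐ[volume] (Set.univ : Set ℝ))) := by
  have hh₀pos : 0 < h₀ := by linarith
  set φ : ℝ → ℝ := fun h => stripePotential f h - 1 with hφ
  have hkpos : 0 < k (2 * h₁) := by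
    by_contra! hcon
    nlinarith [sq_nonneg h₁]
  have hconv : StrictConvexOn ℝ (Set.Ioi 0) φ := by
    have e : φ = stripePotential f + fun _ => -1 := by
      funext h; simp [hφ, sub_eq_add_neg]
    rw [e]
    exact (hk.strictConvexOn_stripePotential (by positivity) hkpos).add_const (-1)
  have hlow : ∀ h, -1 ≤ φ h := fun h => by
    have := hk.stripePotential_nonneg h
    simp only [hφ]; linarith
  have hanti : ∀ x y, 0 < x → x ≤ y → φ y ≤ φ x := fun x y hx hxy => by
    have := hk.stripePotential_anti hx hxy
    simp only [hφ]; linarith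
  have h₀le : φ h₀ ≤ -1 / 2 := by
    have h1 := hk.stripePotential_le hh₀
    have h2 : 2 * c / h₀ ≤ 1 / 2 := by
      rw [div_le_div_iff₀ hh₀pos two_pos]; linarith
    simp only [hφ]; linarith
  have h₁pos : 0 < φ h₁ := by
    have := hk.le_stripePotential hh₁
    simp only [hφ]; linarith
  obtain ⟨s, hs, hs₀, hopt⟩ := exists_optimal_width hconv hlow hanti hh₀pos h₀le hh₁ h₁pos
  have hgrid : ∀ {L : ℝ}, 0 < L → ∀ n : ℕ, 0 < n → PeriodicFinitePerimeter L
      (stripes (L / (2 * n)) 0) ∧ energy k L (stripes (L / (2 * n)) 0) =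
        φ (L / (2 * n)) / (L / (2 * n)) := by
    intro L hL n hn
    have hn' : (0 : ℝ) < n := by exact_mod_cast hn
    have e : L = 2 * n * (L / (2 * n)) := by field_simp
    have hpos : 0 < L / (2 * n) := by positivity
    have h1 := periodicFinitePerimeter_stripes hpos n
    have h2 := energy_stripes hk hpos hn
    rw [← e] at h1 h2
    exact ⟨h1, h2⟩
  have hgap : ∀ {L : ℝ} {g x N}, IsJumpProfile g L N x → ∀ i < N, 0 < x (i + 1) - x i :=
    fun h i hi => sub_pos.2 (h.lt i hi)
  have hsneg : φ s / s < 0 :=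
    (hopt h₀ hh₀pos).trans_lt (div_neg_of_neg_of_pos (by linarith) hh₀pos)
  have hlarge : ∀ L, 2 * h₀ < L → φ (L / (2 * (1 : ℕ))) / (L / (2 * (1 : ℕ))) < 0 := by
    intro L hL
    refine div_neg_of_neg_of_pos ?_ (by push_cast; linarith)
    have := hanti h₀ (L / (2 * (1 : ℕ))) hh₀pos (by push_cast; linarith)
    linarith
  refine ⟨s, ⟨hs, fun L hL E hE => ?_⟩, fun L hL => ?_⟩
  · have h1 := energy_stripes hk hs one_pos
    rw [Nat.cast_one, mul_one] at h1
    rw [h1]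
    rcases energy_eq_zero_or_exists_isJumpProfile hk hL hE with ⟨h0, -⟩ | ⟨N, x, g, hN, hg, hx, hle⟩
    · rw [h0]; exact hsneg.le
    · refine le_trans ?_ hle
      have h2 : ∑ i ∈ Finset.range N, (φ s / s) * (x (i + 1) - x i) ≤
          ∑ i ∈ Finset.range N, φ (x (i + 1) - x i) := by
        refine Finset.sum_le_sum fun i hi => ?_
        have hpos := hgap hx i (Finset.mem_range.1 hi)
        exact (le_div_iff₀ hpos).1 (hopt _ hpos)
      rw [← Finset.mul_sum, hx.sum_gaps] at h2
      rw [one_div_mul_eq_div, le_div_iff₀ hL]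
      exact h2
  -- the energy of a nontrivial set is at least that of stripes with as many boundary points
  have hbound : ∀ E, PeriodicFinitePerimeter L E →
      (energy k L E = 0 ∧ (E =ᵐ[volume] (∅ : Set ℝ) ∨ E =ᵐ[volume] (Set.univ : Set ℝ))) ∨
      ∃ n : ℕ, 0 < n ∧ φ (L / (2 * n)) / (L / (2 * n)) ≤ energy k L E ∧
        (energy k L E ≤ φ (L / (2 * n)) / (L / (2 * n)) →
          IsPeriodicStripes (L / (2 * n)) E) := by
    intro E hE
    rcases energy_eq_zero_or_exists_isJumpProfile hk hL hE with h0 | ⟨N, x, g, hN, hg, hx, hle⟩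
    · exact Or.inl h0
    · right
      obtain ⟨n, hn⟩ := hx.even
      have hNr : (N : ℝ) = 2 * n := by rw [hn]; push_cast; ring
      have hn0 : 0 < n := by omega
      have hn' : (0 : ℝ) < n := by exact_mod_cast hn0
      have hval : φ (L / (2 * n)) / (L / (2 * n)) = 1 / L * (N * φ (L / N)) := by
        rw [hNr]; field_simp
      refine ⟨n, hn0, ?_, fun hge => ?_⟩
      · rw [hval]
        refine le_trans ?_ hle
        gcongr
        exact mul_le_sum_of_convex hconv hN (hgap hx) hx.sum_gaps
      · rw [hval] at hge
        have h1 := hle.trans hge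
        have h2 := le_of_mul_le_mul_left h1 (by positivity)
        rw [← hNr]
        exact hx.isPeriodicStripes hg hN fun i hi =>
          eq_of_sum_le_of_convex hconv hN (ℓ := fun i => x (i + 1) - x i) (hgap hx) hx.sum_gaps h2 hi
  have hzero : energy k L ∅ = 0 := by
    rcases energy_eq_zero_or_exists_isJumpProfile hk hL (periodicFinitePerimeter_empty L) with
      ⟨h0, -⟩ | ⟨N, x, g, hN, hg, hx, -⟩
    · exact h0
    · exfalso
      have h1 : ∀ y, g y = 0 := by
        have : IsStepVersion (fun _ => (0 : ℝ)) ∅ :=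
          ⟨measurable_const, fun _ => Or.inl rfl, Eventually.of_forall fun y => by simp [chi],
            fun x => ⟨1, one_pos, fun _ _ => rfl⟩, fun x => ⟨1, one_pos, 0, fun _ _ => rfl⟩⟩
        intro y
        rw [hg.unique this]
      have := hx.flip 0 hN
      rw [h1, h1] at this
      norm_num at this
  refine ⟨?_, fun E hmin => ?_⟩
  · by_cases hex : ∃ n₀ : ℕ, 0 < n₀ ∧ φ (L / (2 * n₀)) / (L / (2 * n₀)) < 0
    · obtain ⟨n₀, hn₀, hneg⟩ := hex
      obtain ⟨n, hn, hneg', hmin⟩ := exists_grid_min hanti hh₁ h₁pos hL hn₀ hneg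
      refine ⟨stripes (L / (2 * n)) 0, (hgrid hL n hn).1, fun E' hE' => ?_⟩
      rw [(hgrid hL n hn).2]
      rcases hbound E' hE' with ⟨h0, -⟩ | ⟨n', hn', hle, -⟩
      · rw [h0]; exact hneg'.le
      · exact (hmin n' hn').trans hle
    · refine ⟨∅, periodicFinitePerimeter_empty L, fun E' hE' => ?_⟩
      rw [hzero]
      rcases hbound E' hE' with ⟨h0, -⟩ | ⟨n', hn', hle, -⟩
      · rw [h0]
      · by_contra! hcon
        exact hex ⟨n', hn', hle.trans_lt hcon⟩
  · rcases hbound E hmin.1 with ⟨h0, htriv⟩ | ⟨n, hn, hle, hstripes⟩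
    · right
      refine ⟨?_, htriv⟩
      by_contra! hcon
      have h1 := hmin.2 _ (hgrid hL 1 one_pos).1
      rw [h0, (hgrid hL 1 one_pos).2] at h1
      exact absurd h1 (not_le.2 (hlarge L (by nlinarith)))
    · left
      have h1 : ∀ n' : ℕ, 0 < n' → energy k L E ≤ φ (L / (2 * n')) / (L / (2 * n')) :=
        fun n' hn' => (hmin.2 _ (hgrid hL n' hn').1).trans_eq (hgrid hL n' hn').2
      refine ⟨L / (2 * n), hstripes (h1 n hn), ?_⟩
      refine (abs_sub_le_of_grid_min hconv hs hs₀ hopt hL hn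
        fun n' hn' => hle.trans (h1 n' hn')).trans ?_
      gcongr
      linarith

end

/-! ### The kernels -/

/-- The common properties of the `ℓ¹` norm and the Euclidean norm which are used to integrate the
limit kernel over slices. -/
structure IsGauge {m : ℕ} (ρ : EuclideanSpace ℝ (Fin (m + 1)) → ℝ) : Prop where
  continuous : Continuous ρ
  smul : ∀ (t : ℝ) ζ, ρ (t • ζ) = |t| * ρ ζ
  abs_le : ∀ ζ i, |ζ i| ≤ ρ ζ

variable {m : ℕ}

theorem isGauge_sum : IsGauge fun ζ : EuclideanSpace ℝ (Fin (m + 1)) => ∑ i, |ζ i| where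
  continuous := by fun_prop
  smul t ζ := by simp [abs_mul, Finset.mul_sum]
  abs_le ζ i := Finset.single_le_sum (f := fun i => |ζ i|) (fun i _ => abs_nonneg _)
    (Finset.mem_univ i)

theorem isGauge_norm : IsGauge fun ζ : EuclideanSpace ℝ (Fin (m + 1)) => ‖ζ‖ where
  continuous := continuous_norm
  smul t ζ := by rw [norm_smul, Real.norm_eq_abs]
  abs_le ζ i := PiLp.norm_apply_le ζ i

/-- The point of `ℝ^(m+1)` with first coordinate `z` and remaining coordinates `w`. -/
def slice (z : ℝ) (w : Fin m → ℝ) : EuclideanSpace ℝ (Fin (m + 1)) :=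
  WithLp.toLp 2 (Matrix.vecCons z w)

theorem continuous_slice (z : ℝ) : Continuous (slice (m := m) z) := by
  refine (PiLp.continuous_toLp 2 _).comp (continuous_pi fun i => ?_)
  refine Fin.cases ?_ (fun j => ?_) i
  · exact continuous_const
  · exact continuous_apply j

theorem slice_ne_zero {z : ℝ} (hz : z ≠ 0) (w : Fin m → ℝ) : slice z w ≠ 0 := by
  intro h
  have := congrArg (fun ζ : EuclideanSpace ℝ (Fin (m + 1)) => ζ 0) h
  exact hz (by simpa [slice] using this)

theorem smul_slice (t z : ℝ) (w : Fin m → ℝ) : t • slice z w = slice (t * z) (t • w) := by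
  ext i
  refine Fin.cases ?_ (fun j => ?_) i <;> simp [slice]

namespace IsGauge

variable {ρ : EuclideanSpace ℝ (Fin (m + 1)) → ℝ} {p : ℝ}

theorem abs_le_slice (h : IsGauge ρ) (z : ℝ) (w : Fin m → ℝ) : |z| ≤ ρ (slice z w) := by
  simpa [slice] using h.abs_le (slice z w) 0

theorem norm_le_slice (h : IsGauge ρ) (z : ℝ) (w : Fin m → ℝ) : ‖w‖ ≤ ρ (slice z w) := by
  refine (pi_norm_le_iff_of_nonneg ((abs_nonneg z).trans (h.abs_le_slice z w))).2 fun i => ?_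
  simpa [slice] using h.abs_le (slice z w) i.succ

theorem integrable_slice (h : IsGauge ρ) (hp : (m : ℝ) < p) {z : ℝ} (hz : z ≠ 0) :
    Integrable fun w : Fin m → ℝ => 1 / ρ (slice z w) ^ p := by
  have hp0 : 0 ≤ p := (Nat.cast_nonneg m).trans hp.le
  have hz0 : 0 < |z| := abs_pos.2 hz
  have h1 : Integrable fun w : Fin m → ℝ => (1 + 1 / |z|) ^ p * (1 + ‖w‖) ^ (-p) :=
    (integrable_one_add_norm (by simpa using hp)).const_mul _
  have hρ := h.continuous.measurable
  have hs := (continuous_slice (m := m) z).measurable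
  refine h1.mono' (Measurable.aestronglyMeasurable (by fun_prop)) (Eventually.of_forall fun w => ?_)
  have k1 := h.abs_le_slice z w
  have k2 := h.norm_le_slice z w
  have hpos : 0 < ρ (slice z w) := hz0.trans_le k1
  rw [Real.norm_of_nonneg (by positivity), Real.rpow_neg (by positivity), ← div_eq_mul_inv,
    div_le_div_iff₀ (by positivity) (by positivity), one_mul, ← Real.mul_rpow (by positivity) hpos.le]
  refine Real.rpow_le_rpow (by positivity) ?_ hp0
  have k3 : 1 ≤ 1 / |z| * ρ (slice z w) := by
    rw [one_div, ← div_eq_inv_mul, le_div_iff₀ hz0]; linarith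
  linarith

/-- Homogeneity: the substitution `w = z w'` in the integral over a slice. -/
theorem integral_slice (h : IsGauge ρ) {z : ℝ} (hz : z ≠ 0) :
    ∫ w : Fin m → ℝ, 1 / ρ (slice z w) ^ p =
      (∫ w : Fin m → ℝ, 1 / ρ (slice 1 w) ^ p) * |z| ^ (-(p - m)) := by
  have hz0 : 0 < |z| := abs_pos.2 hz
  have e : ∀ w : Fin m → ℝ, 1 / ρ (slice z w) ^ p =
      |z| ^ (-p) * (1 / ρ (slice 1 (z⁻¹ • w)) ^ p) := by
    intro w
    have h1 : slice z w = z • slice 1 (z⁻¹ • w) := by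
      rw [smul_slice, mul_one, smul_inv_smul₀ hz]
    have h2 : 0 ≤ ρ (slice 1 (z⁻¹ • w)) := (abs_nonneg _).trans (h.abs_le_slice 1 (z⁻¹ • w))
    rw [h1, h.smul, Real.mul_rpow hz0.le h2, Real.rpow_neg hz0.le]
    field_simp
  simp only [e]
  rw [integral_const_mul,
    Measure.integral_comp_smul volume (fun w : Fin m → ℝ => 1 / ρ (slice 1 w) ^ p) z⁻¹,
    Module.finrank_fin_fun, inv_pow, inv_inv, abs_pow, smul_eq_mul, neg_sub, sub_eq_add_neg,
    Real.rpow_add hz0, Real.rpow_natCast]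
  ring

theorem integral_slice_one_pos (h : IsGauge ρ) (hp : (m : ℝ) < p) :
    0 < ∫ w : Fin m → ℝ, 1 / ρ (slice 1 w) ^ p := by
  have hpos : ∀ w : Fin m → ℝ, 0 < 1 / ρ (slice 1 w) ^ p := fun w => by
    have : 0 < ρ (slice 1 w) := by
      have := h.abs_le_slice 1 w
      rw [abs_one] at this; linarith
    positivity
  rw [integral_pos_iff_support_of_nonneg (fun w => (hpos w).le) (h.integrable_slice hp one_ne_zero)]
  rw [Set.eq_univ_of_forall (s := Function.support fun w : Fin m → ℝ => 1 / ρ (slice 1 w) ^ p)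
    fun w => (hpos w).ne']
  exact isOpen_univ.measure_pos volume Set.univ_nonempty

end IsGauge

/-- A power is a Laplace transform, by Euler's integral for the Gamma function. The absolute
value in `|α| ^ (q - 1)` only serves to make the function nonnegative for negative `α`. -/
theorem isLaplaceKernel_rpow {k : ℝ → ℝ} {c q : ℝ} (hc : 0 ≤ c) (hq : 3 ≤ q)
    (hk : ∀ z, z ≠ 0 → k z = c * |z| ^ (-q)) :
    IsLaplaceKernel (fun α => c / Real.Gamma q * |α| ^ (q - 1)) k c q := by
  have hΓ : 0 < Real.Gamma q := Real.Gamma_pos_of_pos (by linarith)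
  have e : ∀ z : ℝ, z ≠ 0 → ∫ α in Set.Ioi (0 : ℝ), |α| ^ (q - 1) * Real.exp (-α * |z|) =
      |z| ^ (-q) * Real.Gamma q := by
    intro z hz
    have hz0 : 0 < |z| := abs_pos.2 hz
    have h1 := Real.integral_rpow_mul_exp_neg_mul_Ioi (a := q) (by linarith) hz0
    rw [one_div, Real.inv_rpow hz0.le, ← Real.rpow_neg hz0.le] at h1
    rw [← h1]
    refine setIntegral_congr_fun measurableSet_Ioi fun α hα => ?_
    rw [abs_of_pos hα, neg_mul, mul_comm α]
  refine ⟨by fun_prop, fun α => by positivity, fun z hz => ?_, fun z hz => ?_,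
    fun z hz => (hk z hz).le, hq⟩
  · have h1 : IntegrableOn (fun α => |α| ^ (q - 1) * Real.exp (-α * |z|)) (Set.Ioi 0) := by
      refine .of_integral_ne_zero ?_
      have : 0 < |z| := abs_pos.2 hz
      rw [e z hz]; positivity
    simp only [mul_assoc]
    exact h1.const_mul _
  · simp only [mul_assoc]
    rw [integral_const_mul, e z hz, hk z hz]
    field_simp

namespace IsKernelFamily

variable {p τ₁ τ : ℝ} {K : ℝ → EuclideanSpace ℝ (Fin (m + 1)) → ℝ}

theorem nonneg (hK : IsKernelFamily m p τ₁ K) (h0 : 0 < τ) (h1 : τ < τ₁) (ζ) : 0 ≤ K τ ζ := by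
  obtain ⟨C, hC, H⟩ := hK.bound
  exact le_trans (by positivity) (H τ h0 h1 ζ).1

theorem le_limit (hK : IsKernelFamily m p τ₁ K) (h0 : 0 < τ) (h1 : τ < τ₁) {ζ} (hζ : ζ ≠ 0) :
    K τ ζ ≤ K 0 ζ := by
  refine ge_of_tendsto (hK.tendsto ζ hζ) ?_
  filter_upwards [Ioc_mem_nhdsGT h0] with σ hσ
  exact hK.monotone ζ hζ σ τ hσ.1 hσ.2 h1

theorem exists_gauge (hK : IsKernelFamily m p τ₁ K) :
    ∃ ρ, IsGauge ρ ∧ ∀ ζ, ζ ≠ 0 → K 0 ζ = 1 / ρ ζ ^ p :=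
  hK.limit.elim (fun h => ⟨_, isGauge_sum, h⟩) fun h => ⟨_, isGauge_norm, h⟩

theorem integrable_limit (hK : IsKernelFamily m p τ₁ K) (hp : (m : ℝ) < p) {z : ℝ} (hz : z ≠ 0) :
    Integrable fun w : Fin m → ℝ => K 0 (slice z w) := by
  obtain ⟨ρ, hρ, h⟩ := hK.exists_gauge
  exact (hρ.integrable_slice hp hz).congr
    (Eventually.of_forall fun w => (h _ (slice_ne_zero hz w)).symm)

theorem exists_marginal_limit (hK : IsKernelFamily m p τ₁ K) (hp : (m : ℝ) < p) :
    ∃ c > 0, ∀ z, z ≠ 0 → marginal (K 0) z = c * |z| ^ (-(p - m)) := by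
  obtain ⟨ρ, hρ, h⟩ := hK.exists_gauge
  refine ⟨_, hρ.integral_slice_one_pos hp, fun z hz => ?_⟩
  rw [← hρ.integral_slice hz]
  exact integral_congr_ae (Eventually.of_forall fun w => h _ (slice_ne_zero hz w))

theorem marginal_le (hK : IsKernelFamily m p τ₁ K) (hp : (m : ℝ) < p) (h0 : 0 < τ) (h1 : τ < τ₁)
    {z : ℝ} (hz : z ≠ 0) : marginal (K τ) z ≤ marginal (K 0) z :=
  integral_mono_of_nonneg (Eventually.of_forall fun _ => hK.nonneg h0 h1 _)
    (hK.integrable_limit hp hz)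
    (Eventually.of_forall fun w => hK.le_limit h0 h1 (slice_ne_zero hz w))

theorem tendsto_marginal (hK : IsKernelFamily m p τ₁ K) (hp : (m : ℝ) < p) (hτ₁ : 0 < τ₁)
    {z : ℝ} (hz : z ≠ 0) :
    Tendsto (fun τ => marginal (K τ) z) (𝓝[>] 0) (𝓝 (marginal (K 0) z)) := by
  refine tendsto_integral_filter_of_dominated_convergence
    (fun w : Fin m → ℝ => K 0 (slice z w)) ?_ ?_ (hK.integrable_limit hp hz) ?_
  · filter_upwards [Ioo_mem_nhdsGT hτ₁] with τ hτ
    exact ((hK.measurable τ hτ.1 hτ.2).comp (continuous_slice z).measurable).aestronglyMeasurable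
  · filter_upwards [Ioo_mem_nhdsGT hτ₁] with τ hτ
    refine Eventually.of_forall fun w => ?_
    rw [Real.norm_of_nonneg (hK.nonneg hτ.1 hτ.2 _)]
    exact hK.le_limit hτ.1 hτ.2 (slice_ne_zero hz w)
  · exact Eventually.of_forall fun w => hK.tendsto _ (slice_ne_zero hz w)

/-- All the marginals, including the limit `τ = 0`, are Laplace kernels with the same constant. -/
theorem exists_isLaplaceKernel (hK : IsKernelFamily m p τ₁ K) (hp : (m : ℝ) + 3 ≤ p)
    {c : ℝ} (hc : 0 < c) (hlim : ∀ z, z ≠ 0 → marginal (K 0) z = c * |z| ^ (-(p - m)))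
    (h0 : 0 ≤ τ) (h1 : τ < τ₁) : ∃ f, IsLaplaceKernel f (marginal (K τ)) c (p - m) := by
  rcases h0.eq_or_lt with rfl | hpos
  · exact ⟨_, isLaplaceKernel_rpow hc.le (by linarith) hlim⟩
  · obtain ⟨f, hf, hf0, hfr⟩ := hK.laplace τ hpos h1
    exact ⟨f, hf, hf0, fun z hz => (hfr z hz).1, fun z hz => (hfr z hz).2,
      fun z hz => (hK.marginal_le (by linarith) hpos h1 hz).trans_eq (hlim z hz), by linarith⟩

end IsKernelFamily

/-- `h² · c (2h) ^ (-q)` is large for small `h` because `q ≥ 3`; for `h ≤ c / 16` and `2 h ≤ 1` it is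
at least `c / (8 h) ≥ 2`. -/
theorem exists_small_width {c q : ℝ} (hc : 0 < c) (hq : 3 ≤ q) :
    ∃ h > 0, 1 < h ^ 2 * (c * |2 * h| ^ (-q)) := by
  set h := min (1 / 2) (c / 16) with hh
  have hpos : 0 < h := lt_min (by norm_num) (by positivity)
  have h1 : h ≤ 1 / 2 := min_le_left _ _
  have h2 : h ≤ c / 16 := min_le_right _ _
  refine ⟨h, hpos, ?_⟩
  have h3 : (2 * h) ^ (-3 : ℝ) ≤ (2 * h) ^ (-q) :=
    Real.rpow_le_rpow_of_exponent_ge (by positivity) (by linarith) (by linarith)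
  have h4 : (2 * h) ^ (-3 : ℝ) = 1 / (8 * h ^ 3) := by
    rw [Real.rpow_neg (by positivity), show (3 : ℝ) = (3 : ℕ) by norm_num, Real.rpow_natCast]
    rw [mul_pow]; norm_num
  rw [abs_of_pos (by positivity)]
  calc (1 : ℝ) < 2 := one_lt_two
    _ ≤ c / (8 * h) := by rw [le_div_iff₀ (by positivity)]; linarith
    _ = h ^ 2 * (c * (1 / (8 * h ^ 3))) := by field_simp
    _ ≤ h ^ 2 * (c * (2 * h) ^ (-q)) := by rw [← h4]; gcongr

end

end StripeModel

theorem theorem4p1 (m : ℕ) (p τ₁ : ℝ) (hp : ((m + 1 : ℕ) : ℝ) + 2 ≤ p) (hτ₁ : 0 < τ₁)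
    (K : ℝ → EuclideanSpace ℝ (Fin (m + 1)) → ℝ)
    (hK : StripeModel.IsKernelFamily m p τ₁ K) :
    ∃ C τhat : ℝ, 0 < C ∧ 0 < τhat ∧ ∀ τ : ℝ, 0 ≤ τ → τ < τhat →
      ∃ hstar : ℝ, StripeModel.IsOptimalPeriod (StripeModel.marginal (K τ)) hstar ∧
        ∀ L : ℝ, 0 < L →
          (∃ E : Set ℝ, StripeModel.IsMinimizer (StripeModel.marginal (K τ)) L E) ∧
          ∀ E : Set ℝ, StripeModel.IsMinimizer (StripeModel.marginal (K τ)) L E →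
            (∃ h : ℝ, StripeModel.IsPeriodicStripes h E ∧ |h - hstar| ≤ C / L) ∨
            (L ≤ C ∧ (E =ᵐ[MeasureTheory.volume] (∅ : Set ℝ) ∨
              E =ᵐ[MeasureTheory.volume] (Set.univ : Set ℝ))) := by
  have hp' : (m : ℝ) + 3 ≤ p := by push_cast at hp; linarith
  have hmp : (m : ℝ) < p := by linarith
  obtain ⟨c, hc, hlim⟩ := hK.exists_marginal_limit hmp
  obtain ⟨h₁, hh₁, hbig⟩ := StripeModel.exists_small_width (q := p - m) hc (by linarith)
  have hne : 2 * h₁ ≠ 0 := by positivity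
  rw [← hlim _ hne] at hbig
  have hev : ∀ᶠ τ in 𝓝[>] (0 : ℝ), 1 < h₁ ^ 2 * StripeModel.marginal (K τ) (2 * h₁) :=
    ((hK.tendsto_marginal hmp hτ₁ hne).const_mul _).eventually (lt_mem_nhds hbig)
  obtain ⟨τ₂, hτ₂, hsub⟩ := mem_nhdsGT_iff_exists_Ioo_subset.1 hev
  set h₀ := max 1 (4 * c) with hh₀
  have hh₀1 : 1 ≤ h₀ := le_max_left _ _
  refine ⟨32 * h₀ ^ 2 + 2 * h₀, min τ₁ τ₂, by positivity, lt_min hτ₁ hτ₂, fun τ h0 hτ => ?_⟩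
  obtain ⟨f, hf⟩ := hK.exists_isLaplaceKernel hp' hc hlim h0 (hτ.trans_le (min_le_left _ _))
  refine StripeModel.exists_optimal_of_isLaplaceKernel hf hh₀1 (le_max_right _ _) hh₁ ?_
  rcases h0.eq_or_lt with rfl | hpos
  · exact hbig
  · exact hsub ⟨hpos, hτ.trans_le (min_le_right _ _)⟩
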